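/- **Theorem 4.2 (Basic facts on $mJ_1$).** Let $T>0$ and let $\mathbb D=\mathbb D([0,T])$ be the set of functions $x:[0,T]\to\mathbb R$ that are right-continuous at every $t\in[0,T)$ and admit finite left limits at every $t\in(0,T]$. Fix $\varepsilon>0$ and, for $x\in\mathbb D$, let $\tilde x\in\mathbb D([-\varepsilon,T+\varepsilon])$ be given by $\tilde x(t)=0$ for $-\varepsilon\le t<0$, $\tilde x(t)=x(t)$ for $0\le t<T$, and $\tilde x(t)=x(T)$ for $T\le t\le T+\varepsilon$. Put $d(x,y)=d_{Sk}(\tilde x,\tilde y)$, where $d_{Sk}$ is Billingsley's complete metric for the Skorokhod $J_1$ topology on $\mathbb D([-\varepsilon,T+\varepsilon])$: $d_{Sk}(z,w)$ is the infimum of those $c>0$ for which there is an increasing bijection $\lambda$ of $[-\varepsilon,T+\varepsilon]$ onto itself with $$\sup_{s<t}\left|\log\frac{\lambda(t)-\lambda(s)}{t-s}\right|\le c\quad\text{and}\quad \sup_{t}|z(t)-w(\lambda(t))|\le c .$$ The topology of the metric space $(\mathbb D,d)$ is called $mJ_1$. Then: (i) $(\mathbb D,d)$ is a complete separable metric space.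 (ii) A subset $K\subset\mathbb D$ is relatively $mJ_1$-compact (its $mJ_1$-closure is compact) if and only if it is uniformly bounded, $$\sup_{x\in K}\sup_{t\in[0,T]}|x(t)|<+\infty,$$ and $$\lim_{\delta\to0+}\ \sup_{x\in K}\ \sup_{\substack{0-\le s<t<u\le T\\ u-s<\delta}}\min\{|x(t)-x(s)|,\,|x(u)-x(t)|\}=0,$$ where $s$ ranges over $\{0-\}\cup[0,T]$ and $t,u$ over $[0,T]$, with the conventions $0-<t$ for all $t\in[0,T]$, $x(0-)=0$ and $u-(0-)=u$. (Suprema over empty sets are $0$.) (iii) For each $A>0$ the set $\{a\,\mathbf 1_{[u,T]} : |a|\le A,\ u\in[0,T]\}$ is relatively $mJ_1$-compact. -/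

import Mathlib

open Set Filter Topology
open scoped ENNReal

/-- The space `D([a, b])` of real càdlàg functions on `[a, b]`: right-continuous at every point
of `[a, b)`, with a finite left limit at every point of `(a, b]`. Neighbourhoods are taken in the
subspace `[a, b]`, so the first condition is void at `b` and the second one is void at `a`. -/
@[ext]
structure Cadlag (a b : ℝ) where
  toFun : Icc a b → ℝ
  right_cont : ∀ t, ContinuousWithinAt toFun (Ici t) t
  left_lim : ∀ t, ∃ l, Tendsto toFun (𝓝[<] t) (𝓝 l)

namespace Cadlag

instance (a b : ℝ) : CoeFun (Cadlag a b) (fun _ => Icc a b → ℝ) := ⟨Cadlag.toFun⟩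

variable {a b : ℝ}

/-- A càdlàg function on a compact interval is bounded. -/
theorem exists_bound (x : Cadlag a b) : ∃ C : ℝ, ∀ t, |x t| ≤ C := by
  have key : ∃ C : ℝ, ∀ t ∈ (univ : Set (Icc a b)), |x t| ≤ C := by
    refine isCompact_univ.induction_on (p := fun s => ∃ C : ℝ, ∀ t ∈ s, |x t| ≤ C)
      ⟨0, by simp⟩ ?_ ?_ ?_
    · rintro s t hst ⟨C, hC⟩
      exact ⟨C, fun u hu => hC u (hst hu)⟩
    · rintro s t ⟨C, hC⟩ ⟨C', hC'⟩
      refine ⟨max C C', fun u hu => ?_⟩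
      rcases hu with hu | hu
      · exact (hC u hu).trans (le_max_left _ _)
      · exact (hC' u hu).trans (le_max_right _ _)
    · intro t _
      obtain ⟨l, hl⟩ := x.left_lim t
      have h1 : ∀ᶠ s in 𝓝[<] t, |x s| ≤ max (|l| + 1) (|x t| + 1) := by
        filter_upwards [hl.abs.eventually (gt_mem_nhds (lt_add_one |l|))] with s hs
        exact hs.le.trans (le_max_left _ _)
      have h2 : ∀ᶠ s in 𝓝[≥] t, |x s| ≤ max (|l| + 1) (|x t| + 1) := by
        filter_upwards [(x.right_cont t).tendsto.abs.eventually
          (gt_mem_nhds (lt_add_one |x t|))] with s hs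
        exact hs.le.trans (le_max_right _ _)
      have h3 : ∀ᶠ s in 𝓝 t, |x s| ≤ max (|l| + 1) (|x t| + 1) := by
        rw [← nhdsLT_sup_nhdsGE]
        exact mem_sup.2 ⟨h1, h2⟩
      rw [nhdsWithin_univ]
      exact ⟨{s | |x s| ≤ max (|l| + 1) (|x t| + 1)}, h3, _, fun s hs => hs⟩
  obtain ⟨C, hC⟩ := key
  exact ⟨C, fun t => hC t (mem_univ t)⟩

/-- `SkorokhodClose x y c`: some time change `γ`, i.e. an increasing bijection of `[a, b]` (which
is then a homeomorphism), satisfies `sup_{s < t} |log ((γ t - γ s) / (t - s))| ≤ c` and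
`sup_t |x t - y (γ t)| ≤ c`. -/
def SkorokhodClose (x y : Cadlag a b) (c : ℝ) : Prop :=
  ∃ γ : Icc a b ≃o Icc a b,
    (∀ s t : Icc a b, s < t →
      |Real.log (((γ t : ℝ) - (γ s : ℝ)) / ((t : ℝ) - (s : ℝ)))| ≤ c) ∧
    ∀ t, |x t - y (γ t)| ≤ c

/-- The complete (Billingsley) metric of the `J₁` topology on `D([a, b])`: the infimum of those
positive `c` for which some time change is within `c` of the identity (in the logarithmic sense)
and brings `y` uniformly within `c` of `x`. -/
noncomputable def skorokhodDist (x y : Cadlag a b) : ℝ :=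
  sInf {c : ℝ | 0 < c ∧ SkorokhodClose x y c}

theorem skorokhodClose_nonempty (x y : Cadlag a b) :
    {c : ℝ | 0 < c ∧ SkorokhodClose x y c}.Nonempty := by
  obtain ⟨C, hC⟩ := x.exists_bound
  obtain ⟨C', hC'⟩ := y.exists_bound
  refine ⟨|C| + |C'| + 1, by positivity, OrderIso.refl _, ?_, ?_⟩
  · intro s t hst
    have h : (0 : ℝ) < (t : ℝ) - (s : ℝ) := sub_pos.2 hst
    simp only [OrderIso.refl_apply, div_self h.ne', Real.log_one, abs_zero]
    positivity
  · intro t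
    have := abs_sub (x t) (y t)
    have := hC t
    have := hC' t
    have := le_abs_self C
    have := le_abs_self C'
    simp only [OrderIso.refl_apply]
    linarith

theorem skorokhodClose_bddBelow (x y : Cadlag a b) :
    BddBelow {c : ℝ | 0 < c ∧ SkorokhodClose x y c} := ⟨0, fun _ hc => hc.1.le⟩

theorem skorokhodClose_of_dist_lt {x y : Cadlag a b} {c : ℝ} (h : skorokhodDist x y < c) :
    ∃ c' < c, 0 < c' ∧ SkorokhodClose x y c' := by
  obtain ⟨c', hc', hlt⟩ := exists_lt_of_csInf_lt (skorokhodClose_nonempty x y) h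
  exact ⟨c', hlt, hc'⟩

theorem skorokhodDist_le {x y : Cadlag a b} {c : ℝ} (hc : 0 < c) (h : SkorokhodClose x y c) :
    skorokhodDist x y ≤ c := csInf_le (skorokhodClose_bddBelow x y) ⟨hc, h⟩

theorem SkorokhodClose.refl (x : Cadlag a b) {c : ℝ} (hc : 0 < c) : SkorokhodClose x x c := by
  refine ⟨OrderIso.refl _, ?_, ?_⟩
  · intro s t hst
    have h : (0 : ℝ) < (t : ℝ) - (s : ℝ) := sub_pos.2 hst
    simp only [OrderIso.refl_apply, div_self h.ne', Real.log_one, abs_zero]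
    exact hc.le
  · intro t
    simpa using hc.le

theorem SkorokhodClose.symm {x y : Cadlag a b} {c : ℝ} (h : SkorokhodClose x y c) :
    SkorokhodClose y x c := by
  obtain ⟨γ, h1, h2⟩ := h
  refine ⟨γ.symm, ?_, ?_⟩
  · intro s t hst
    have := h1 (γ.symm s) (γ.symm t) (γ.symm.lt_iff_lt.2 hst)
    rw [γ.apply_symm_apply, γ.apply_symm_apply, ← inv_div, Real.log_inv, abs_neg] at this
    exact this
  · intro t
    have := h2 (γ.symm t)
    rwa [γ.apply_symm_apply, abs_sub_comm] at this

theorem SkorokhodClose.trans {x y z : Cadlag a b} {c c' : ℝ} (h : SkorokhodClose x y c)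
    (h' : SkorokhodClose y z c') : SkorokhodClose x z (c + c') := by
  obtain ⟨γ, h1, h2⟩ := h
  obtain ⟨η, h1', h2'⟩ := h'
  refine ⟨γ.trans η, ?_, ?_⟩
  · intro s t hst
    have hγ : γ s < γ t := γ.lt_iff_lt.2 hst
    have hη : η (γ s) < η (γ t) := η.lt_iff_lt.2 hγ
    have p1 : (0 : ℝ) < (t : ℝ) - s := sub_pos.2 hst
    have p2 : (0 : ℝ) < (γ t : ℝ) - γ s := sub_pos.2 hγ
    have p3 : (0 : ℝ) < (η (γ t) : ℝ) - η (γ s) := sub_pos.2 hη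
    have e : ((η (γ t) : ℝ) - η (γ s)) / ((t : ℝ) - s) =
        (((γ t : ℝ) - γ s) / ((t : ℝ) - s)) *
          (((η (γ t) : ℝ) - η (γ s)) / ((γ t : ℝ) - γ s)) := by
      field_simp
    simp only [OrderIso.trans_apply]
    rw [e, Real.log_mul (div_pos p2 p1).ne' (div_pos p3 p2).ne']
    exact (abs_add_le _ _).trans (add_le_add (h1 s t hst) (h1' _ _ hγ))
  · intro t
    simp only [OrderIso.trans_apply]
    exact (abs_sub_le _ (y (γ t)) _).trans (add_le_add (h2 t) (h2' (γ t)))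

theorem skorokhodDist_self (x : Cadlag a b) : skorokhodDist x x = 0 := by
  refine le_antisymm (le_of_forall_pos_le_add fun c hc => ?_)
    (Real.sInf_nonneg fun _ hc => hc.1.le)
  rw [zero_add]
  exact skorokhodDist_le hc (SkorokhodClose.refl x hc)

theorem skorokhodDist_comm (x y : Cadlag a b) : skorokhodDist x y = skorokhodDist y x := by
  have : ∀ c, SkorokhodClose x y c ↔ SkorokhodClose y x c := fun c =>
    ⟨SkorokhodClose.symm, SkorokhodClose.symm⟩
  simp only [skorokhodDist, this]

theorem skorokhodDist_triangle (x y z : Cadlag a b) :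
    skorokhodDist x z ≤ skorokhodDist x y + skorokhodDist y z := by
  refine le_of_forall_pos_le_add fun e he => ?_
  obtain ⟨c, hc, hc0, h⟩ := skorokhodClose_of_dist_lt
    (show skorokhodDist x y < skorokhodDist x y + e / 2 by linarith)
  obtain ⟨c', hc', hc0', h'⟩ := skorokhodClose_of_dist_lt
    (show skorokhodDist y z < skorokhodDist y z + e / 2 by linarith)
  have := skorokhodDist_le (add_pos hc0 hc0') (h.trans h')
  linarith

theorem eq_of_skorokhodDist_eq_zero {x y : Cadlag a b} (h : skorokhodDist x y = 0) : x = y := by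
  have close : ∀ c > 0, SkorokhodClose x y c := by
    intro c hc
    obtain ⟨c', hlt, -, γ, h1, h2⟩ := skorokhodClose_of_dist_lt (h.trans_lt hc)
    exact ⟨γ, fun s t hst => (h1 s t hst).trans hlt.le, fun t => (h2 t).trans hlt.le⟩
  have left_fix : ∀ (γ : Icc a b ≃o Icc a b) (p : Icc a b), (∀ t, p ≤ t) → γ p = p := by
    intro γ p hp
    refine le_antisymm ?_ (hp _)
    have := γ.le_iff_le.2 (hp (γ.symm p))
    rwa [γ.apply_symm_apply] at this
  have right_fix : ∀ (γ : Icc a b ≃o Icc a b) (p : Icc a b), (∀ t, t ≤ p) → γ p = p := by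
    intro γ p hp
    refine le_antisymm (hp _) ?_
    have := γ.le_iff_le.2 (hp (γ.symm p))
    rwa [γ.apply_symm_apply] at this
  -- time changes which are logarithmically close to the identity are pointwise close to it
  have near : ∀ (s : Icc a b) (U : Set (Icc a b)), U ∈ 𝓝 s → ∀ e > 0, ∃ v ∈ U,
      |x s - y v| ≤ e := by
    intro s U hU e he
    have hab : a ≤ b := s.2.1.trans s.2.2
    let p : Icc a b := ⟨a, le_refl a, hab⟩
    have hp : ∀ t, p ≤ t := fun t => t.2.1
    rcases (hp s).eq_or_lt with hs | hs
    · obtain ⟨γ, -, h2⟩ := close e he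
      have h3 := h2 s
      rw [← hs, left_fix γ p hp] at h3
      rw [← hs] at hU ⊢
      exact ⟨p, mem_of_mem_nhds hU, h3⟩
    · have hs' : (0 : ℝ) < (s : ℝ) - a := sub_pos.2 hs
      obtain ⟨r, hr, hrU⟩ := Metric.mem_nhds_iff.1 hU
      have tend1 : Tendsto (fun c : ℝ => Real.exp c * ((s : ℝ) - a)) (𝓝[>] 0)
          (𝓝 ((s : ℝ) - a)) := by
        have : Continuous (fun c : ℝ => Real.exp c * ((s : ℝ) - a)) := by fun_prop
        simpa using (this.tendsto 0).mono_left nhdsWithin_le_nhds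
      have tend2 : Tendsto (fun c : ℝ => Real.exp (-c) * ((s : ℝ) - a)) (𝓝[>] 0)
          (𝓝 ((s : ℝ) - a)) := by
        have : Continuous (fun c : ℝ => Real.exp (-c) * ((s : ℝ) - a)) := by fun_prop
        simpa using (this.tendsto 0).mono_left nhdsWithin_le_nhds
      obtain ⟨c, ⟨⟨hc1, hc2⟩, hc3⟩, hc0⟩ :=
        (((tend1.eventually (gt_mem_nhds (show (s : ℝ) - a < (s : ℝ) - a + r by linarith))).and
        (tend2.eventually (lt_mem_nhds (show (s : ℝ) - a - r < (s : ℝ) - a by linarith)))).and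
        (nhdsWithin_le_nhds (gt_mem_nhds he))).and self_mem_nhdsWithin |>.exists
      have hc0 : 0 < c := hc0
      obtain ⟨γ, h1, h2⟩ := close c hc0
      refine ⟨γ s, hrU ?_, (h2 s).trans hc3.le⟩
      have h3 := h1 p s hs
      have hγ : γ p < γ s := γ.lt_iff_lt.2 hs
      rw [left_fix γ p hp] at h3 hγ
      have pos : (0 : ℝ) < (γ s : ℝ) - (p : ℝ) := sub_pos.2 hγ
      have hpa : (p : ℝ) = a := rfl
      rw [hpa] at h3 pos
      have hq := div_pos pos hs'
      obtain ⟨h4, h5⟩ := abs_le.1 h3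
      have h6 := (Real.log_le_iff_le_exp hq).1 h5
      have h7 := (Real.le_log_iff_exp_le hq).1 h4
      rw [div_le_iff₀ hs'] at h6
      rw [le_div_iff₀ hs'] at h7
      rw [Metric.mem_ball, Subtype.dist_eq, Real.dist_eq, abs_lt]
      constructor <;> linarith
  ext t
  by_cases hb : ∀ s, s ≤ t
  · refine sub_eq_zero.1 (abs_nonpos_iff.1 (le_of_forall_pos_le_add fun e he => ?_))
    rw [zero_add]
    obtain ⟨γ, -, h2⟩ := close e he
    simpa [right_fix γ t hb] using h2 t
  · push Not at hb
    obtain ⟨w, hw⟩ := hb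
    have hwr : (t : ℝ) < w := hw
    have ne : (𝓝[>] t).NeBot := by
      refine mem_closure_iff_nhdsWithin_neBot.1 (Metric.mem_closure_iff.2 fun e he => ?_)
      have hm : 0 < min (e / 2) ((w : ℝ) - t) := lt_min (by linarith) (by linarith)
      have m1 := min_le_left (e / 2) ((w : ℝ) - t)
      have m2 := min_le_right (e / 2) ((w : ℝ) - t)
      have ht1 := t.2.1
      have hw2 := w.2.2
      refine ⟨⟨t + min (e / 2) ((w : ℝ) - t), by linarith, by linarith⟩, ?_, ?_⟩
      · show (t : ℝ) < t + min (e / 2) ((w : ℝ) - t)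
        linarith
      · rw [Subtype.dist_eq, Real.dist_eq, abs_lt]
        constructor <;> simp only <;> linarith
    have hx : Tendsto x (𝓝[>] t) (𝓝 (x t)) :=
      (x.right_cont t).tendsto.mono_left (nhdsWithin_mono _ Ioi_subset_Ici_self)
    refine sub_eq_zero.1 (abs_nonpos_iff.1 (le_of_forall_pos_le_add fun e he => ?_))
    rw [zero_add]
    have hy : ∀ᶠ s in 𝓝[>] t, |y s - y t| < e / 2 := by
      have hy' : Tendsto y (𝓝[>] t) (𝓝 (y t)) :=
        (y.right_cont t).tendsto.mono_left (nhdsWithin_mono _ Ioi_subset_Ici_self)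
      exact (Metric.tendsto_nhds.1 hy') (e / 2) (by linarith)
    have hxy : ∀ᶠ s in 𝓝[>] t, |x s - y t| ≤ e := by
      rw [eventually_nhdsWithin_iff] at hy
      filter_upwards [eventually_nhdsWithin_of_eventually_nhds hy.eventually_nhds,
        self_mem_nhdsWithin] with s hs hst
      obtain ⟨v, ⟨hv1, hv2⟩, hv⟩ := near s _ (hs.and (isOpen_Ioi.mem_nhds hst)) (e / 2)
        (by linarith)
      have := abs_sub_le (x s) (y v) (y t)
      have := hv1 hv2
      linarith
    exact le_of_tendsto (hx.sub_const (y t)).abs hxy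

variable {T ε : ℝ}

/-- The extension `x̃ ∈ D([-ε, T + ε])` of `x ∈ D([0, T])`: it is `0` on `[-ε, 0)`, `x` on
`[0, T)`, and `x T` on `[T, T + ε]`. -/
noncomputable def extend (hT : 0 < T) (x : Cadlag 0 T) : Cadlag (-ε) (T + ε) where
  toFun t := if (t : ℝ) < 0 then 0 else x (projIcc 0 T hT.le t)
  right_cont := by
    intro t
    by_cases ht : (t : ℝ) < 0
    · have h : ∀ᶠ s : Icc (-ε) (T + ε) in 𝓝[≥] t, (s : ℝ) < 0 :=
        nhdsWithin_le_nhds ((continuous_subtype_val.tendsto t).eventually (gt_mem_nhds ht))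
      refine (continuousWithinAt_const (b := (0 : ℝ))).congr_of_eventuallyEq ?_ (by simp [ht])
      filter_upwards [h] with s hs
      simp [hs]
    · have hp : ContinuousWithinAt (fun s : Icc (-ε) (T + ε) => x (projIcc 0 T hT.le s))
          (Ici t) t := by
        refine ContinuousWithinAt.comp (t := Ici (projIcc 0 T hT.le t)) (x.right_cont _)
          (continuous_projIcc.comp continuous_subtype_val).continuousWithinAt ?_
        intro s hs
        exact monotone_projIcc hT.le (Subtype.coe_le_coe.2 hs)
      refine hp.congr (fun s hs => ?_) (by simp [ht])
      have : (t : ℝ) ≤ s := hs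
      rw [if_neg (by linarith)]
  left_lim := by
    intro t
    rcases le_or_gt (t : ℝ) 0 with ht | ht
    · refine ⟨0, tendsto_const_nhds.congr' ?_⟩
      filter_upwards [self_mem_nhdsWithin] with s hs
      have : (s : ℝ) < t := hs
      rw [if_pos (by linarith)]
    · have hpos : ∀ᶠ s : Icc (-ε) (T + ε) in 𝓝[<] t, 0 < (s : ℝ) :=
        nhdsWithin_le_nhds ((continuous_subtype_val.tendsto t).eventually (lt_mem_nhds ht))
      rcases le_or_gt (t : ℝ) T with htT | htT
      · obtain ⟨l, hl⟩ := x.left_lim (projIcc 0 T hT.le t)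
        refine ⟨l, (hl.comp (f := fun s : Icc (-ε) (T + ε) => projIcc 0 T hT.le s)
          (x := 𝓝[<] t) ?_).congr' ?_⟩
        · refine tendsto_nhdsWithin_iff.2 ⟨?_, ?_⟩
          · exact ((continuous_projIcc.comp continuous_subtype_val).tendsto t).mono_left
              nhdsWithin_le_nhds
          · filter_upwards [hpos, self_mem_nhdsWithin] with s hs hst
            have hst' : (s : ℝ) < t := hst
            rw [mem_Iio, projIcc_of_mem hT.le ⟨hs.le, by linarith⟩,
              projIcc_of_mem hT.le ⟨ht.le, htT⟩]
            exact hst'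
        · filter_upwards [hpos] with s hs
          simp [not_lt.2 hs.le]
      · refine ⟨x ⟨T, hT.le, le_refl T⟩, tendsto_const_nhds.congr' ?_⟩
        have hTs : ∀ᶠ s : Icc (-ε) (T + ε) in 𝓝[<] t, T < (s : ℝ) :=
          nhdsWithin_le_nhds ((continuous_subtype_val.tendsto t).eventually (lt_mem_nhds htT))
        filter_upwards [hTs] with s hs
        rw [if_neg (by linarith), projIcc_of_right_le hT.le hs.le]

theorem extend_injective (hT : 0 < T) (hε : 0 < ε) :
    Function.Injective (extend (ε := ε) hT) := by
  intro x y h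
  ext t
  have h1 := congrArg
    (fun z : Cadlag (-ε) (T + ε) => z ⟨t, by linarith [t.2.1], by linarith [t.2.2]⟩) h
  simpa [extend, not_lt.2 t.2.1] using h1

/-- The metric space `(D([0, T]), d)` with `d(x, y) = d_Sk(x̃, ỹ)`. Its topology is the `mJ₁`
topology. -/
noncomputable abbrev mJ1MetricSpace (hT : 0 < T) (hε : 0 < ε) : MetricSpace (Cadlag 0 T) where
  dist x y := skorokhodDist (extend (ε := ε) hT x) (extend (ε := ε) hT y)
  dist_self _ := skorokhodDist_self _
  dist_comm _ _ := skorokhodDist_comm _ _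
  dist_triangle _ _ _ := skorokhodDist_triangle _ _ _
  eq_of_dist_eq_zero h := extend_injective hT hε (eq_of_skorokhodDist_eq_zero h)

/-- The value at a time of `{0-} ∪ [0, T]`; the extra least element `⊥` is the time `0-`, and
`x(0-) = 0`. -/
def valueFromZeroMinus (x : Cadlag 0 T) : WithBot (Icc 0 T) → ℝ
  | ⊥ => 0
  | (s : Icc 0 T) => x s

/-- The length `u - s` for a time `s` of `{0-} ∪ [0, T]`, with `u - (0-) = u`. -/
def lengthFromZeroMinus (u : Icc 0 T) : WithBot (Icc 0 T) → ℝ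
  | ⊥ => u
  | (s : Icc 0 T) => (u : ℝ) - s

/-- The modulus `sup min {|x t - x s|, |x u - x t|}`, over `0- ≤ s < t < u ≤ T` with
`u - s < δ`. -/
noncomputable def mJ1Modulus (x : Cadlag 0 T) (δ : ℝ) : ℝ≥0∞ :=
  ⨆ (s : WithBot (Icc 0 T)) (t : Icc 0 T) (u : Icc 0 T)
    (_ : s < (t : WithBot (Icc 0 T)) ∧ t < u ∧ lengthFromZeroMinus u s < δ),
    ENNReal.ofReal (min |x t - x.valueFromZeroMinus s| |x u - x t|)

/-- `sup_{x ∈ K} sup_{t ∈ [0, T]} |x t|`. -/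
noncomputable def supAbs (K : Set (Cadlag 0 T)) : ℝ≥0∞ :=
  ⨆ x ∈ K, ⨆ t : Icc 0 T, ENNReal.ofReal |x t|

/-- The supremum over `x ∈ K` of `mJ1Modulus x δ`. -/
noncomputable def supModulus (K : Set (Cadlag 0 T)) (δ : ℝ) : ℝ≥0∞ :=
  ⨆ x ∈ K, mJ1Modulus x δ

/-- The single jump `c · 1_{[u, T]}` as an element of `D([0, T])`. -/
noncomputable def singleJump (c : ℝ) (u : Icc 0 T) : Cadlag 0 T where
  toFun := (Ici u).indicator fun _ => c
  right_cont := by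
    intro t
    by_cases ht : u ≤ t
    · refine (continuousWithinAt_const (b := c)).congr (fun s hs => ?_) ?_
      · exact indicator_of_mem (mem_Ici.2 (ht.trans hs)) _
      · exact indicator_of_mem (mem_Ici.2 ht) _
    · refine (continuousWithinAt_const (b := (0 : ℝ))).congr_of_eventuallyEq ?_ ?_
      · filter_upwards [nhdsWithin_le_nhds (gt_mem_nhds (not_le.1 ht))] with s hs
        exact indicator_of_notMem (by simpa using hs) _
      · exact indicator_of_notMem (by simpa using ht) _
  left_lim := by
    intro t
    by_cases ht : t ≤ u
    · refine ⟨0, tendsto_const_nhds.congr' ?_⟩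
      filter_upwards [self_mem_nhdsWithin] with s hs
      exact (indicator_of_notMem (by simpa using lt_of_lt_of_le hs ht) _).symm
    · refine ⟨c, tendsto_const_nhds.congr' ?_⟩
      filter_upwards [nhdsWithin_le_nhds (lt_mem_nhds (not_le.1 ht))] with s hs
      exact (indicator_of_mem (mem_Ici.2 hs.le) fun _ => c).symm

end Cadlag

/-! Each path is extended to the whole line, by `0` before time `0` and by its final value after
`T`. Time changes of `[-ε, T + ε]` fix both endpoints, so they extend by the identity, and the
logarithmic condition becomes a two-sided bound on slopes. It composes additively in `c`.

Completeness: take `u n` with consecutive distances below `(1/2)^n` and time changes `γ n` matching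
`u n` to `u (n + 1)`. Because the logarithmic slopes are summable, the compositions of the `γ n`
converge to a time change. Undoing this limit gives maps `A n`, tending to the identity, along which
`u n ∘ A n` is uniformly Cauchy. The limit is càdlàg, is still constant outside `[0, T]`, and is the
limit of `u n` for the metric (`IsTimeChange.exists_infinite_comp`, `mJ1_completeSpace`).

Separability and compactness share one discretization. The three-point modulus says that a short
window contains at most one substantial change, so `[-ε, T + ε]` splits into pieces of length
bounded below on which the path is nearly constant (`WindowSmall.exists_oscPartition`). Rounding the
cut points and the values there gives a code. Paths with equal codes are close, since the piecewise
affine map between their partitions has slopes near `1` (`OscPartition.exists_timeChange`). There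
are countably many codes in all, and finitely many under uniform bounds, whence total boundedness.

Conversely, bounds on values and on the modulus survive a time change up to a small loss, so they
pass from a finite net to the whole set. -/

/-! ### Time changes of the line. -/

/-- An increasing bijection `γ` of the line whose difference quotients lie in
`[exp (-c), exp c]`. -/
def IsTimeChange (c : ℝ) (γ : ℝ → ℝ) : Prop :=
  ∀ s t, s ≤ t → Real.exp (-c) * (t - s) ≤ γ t - γ s ∧ γ t - γ s ≤ Real.exp c * (t - s)

namespace IsTimeChange

variable {c c' : ℝ} {γ η : ℝ → ℝ}

theorem strictMono (h : IsTimeChange c γ) : StrictMono γ := by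
  intro s t hst
  have h1 := (h s t hst.le).1
  have h2 := mul_pos (Real.exp_pos (-c)) (sub_pos.2 hst)
  linarith

theorem continuous (h : IsTimeChange c γ) : Continuous γ := by
  refine (LipschitzWith.of_le_add_mul (Real.toNNReal (Real.exp c)) fun s t => ?_).continuous
  rw [Real.coe_toNNReal _ (Real.exp_pos c).le, Real.dist_eq]
  rcases le_total s t with hst | hst
  · have h1 := h.strictMono.monotone hst
    have h2 := mul_nonneg (Real.exp_pos c).le (abs_nonneg (s - t))
    linarith
  · rw [abs_of_nonneg (sub_nonneg.2 hst)]
    linarith [(h t s hst).2]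

theorem surjective (h : IsTimeChange c γ) : Function.Surjective γ := by
  have hp := Real.exp_pos (-c)
  refine h.continuous.surjective ?_ ?_
  · refine tendsto_atTop_mono' _ (f₁ := fun t => γ 0 + Real.exp (-c) * t) ?_ ?_
    · filter_upwards [eventually_ge_atTop 0] with t ht
      linarith [(h 0 t ht).1]
    · exact tendsto_atTop_add_const_left _ _ (tendsto_id.const_mul_atTop hp)
  · have h1 : Tendsto (fun t => γ 0 + Real.exp (-c) * t) atBot atBot :=
      tendsto_atBot_add_const_left _ _ (tendsto_id.const_mul_atBot hp)
    refine tendsto_atBot_mono' _ ?_ h1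
    filter_upwards [eventually_le_atBot 0] with t ht
    linarith [(h t 0 ht).1]

theorem exists_inverse (h : IsTimeChange c γ) :
    ∃ η, IsTimeChange c η ∧ Function.LeftInverse η γ ∧ Function.RightInverse η γ := by
  let e := h.strictMono.orderIsoOfSurjective γ h.surjective
  have h1 : ∀ t, γ (e.symm t) = t := e.apply_symm_apply
  refine ⟨e.symm, fun s t hst => ?_, e.symm_apply_apply, h1⟩
  obtain ⟨h2, h3⟩ := h _ _ (e.symm.monotone hst)
  rw [h1, h1] at h2 h3
  have hmul : Real.exp (-c) * Real.exp c = 1 := by rw [← Real.exp_add]; simp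
  constructor
  · have := mul_le_mul_of_nonneg_left h3 (Real.exp_pos (-c)).le
    rwa [← mul_assoc, hmul, one_mul] at this
  · have := mul_le_mul_of_nonneg_left h2 (Real.exp_pos c).le
    rwa [← mul_assoc, mul_comm (Real.exp c), hmul, one_mul] at this

/-- Since `γ a = a`, the displacement at `t` is at most `t - a` times the deviation of the slope
from `1`, and `exp c - 1 ≤ 2 * c` for `c ≤ 1`. -/
theorem abs_sub_self_le {a b : ℝ} (hab : a ≤ b) (h : IsTimeChange c γ) (hc : 0 ≤ c) (hc1 : c ≤ 1)
    (hγ : ∀ t, t ∉ Ioo a b → γ t = t) (t : ℝ) : |γ t - t| ≤ 2 * (b - a) * c := by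
  by_cases ht : t ∈ Ioo a b
  · have ha : γ a = a := hγ a (by simp)
    obtain ⟨h1, h2⟩ := h a t ht.1.le
    have e1 := (abs_le.1 (Real.abs_exp_sub_one_le (abs_le.2 ⟨by linarith, hc1⟩))).2
    rw [abs_of_nonneg hc] at e1
    have e2 := Real.add_one_le_exp (-c)
    have h3 : 0 ≤ t - a := sub_nonneg.2 ht.1.le
    have h4 : t - a ≤ b - a := by linarith [ht.2]
    have m1 := mul_le_mul_of_nonneg_right e1 h3
    have m2 := mul_le_mul_of_nonneg_right e2 h3
    have m3 := mul_le_mul_of_nonneg_right h4 hc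
    have m4 := mul_nonneg h3 hc
    rw [abs_le]
    constructor <;> linarith
  · rw [hγ t ht, sub_self, abs_zero]
    have := sub_nonneg.2 hab
    positivity

end IsTimeChange

/-! ### Càdlàg functions on the line. -/

/-- A function on the line that is right-continuous with left limits. -/
def IsCadlag (f : ℝ → ℝ) : Prop :=
  (∀ t, ContinuousWithinAt f (Ici t) t) ∧ ∀ t, ∃ l, Tendsto f (𝓝[<] t) (𝓝 l)

namespace IsCadlag

theorem comp_strictMono {f γ : ℝ → ℝ} (hf : IsCadlag f) (hγ : StrictMono γ)
    (hγc : Continuous γ) : IsCadlag (f ∘ γ) := by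
  refine ⟨fun t => (hf.1 (γ t)).comp hγc.continuousWithinAt fun s hs => hγ.monotone hs,
    fun t => ?_⟩
  obtain ⟨l, hl⟩ := hf.2 (γ t)
  refine ⟨l, hl.comp (tendsto_nhdsWithin_iff.2 ⟨(hγc.tendsto t).mono_left nhdsWithin_le_nhds, ?_⟩)⟩
  filter_upwards [self_mem_nhdsWithin] with s hs
  exact hγ hs

theorem of_uniform_approx {f : ℝ → ℝ} (h : ∀ e > 0, ∃ g, IsCadlag g ∧ ∀ t, |f t - g t| ≤ e) :
    IsCadlag f := by
  constructor
  · intro t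
    refine Metric.tendsto_nhds.2 fun e he => ?_
    obtain ⟨g, hg, hfg⟩ := h (e / 3) (by linarith)
    filter_upwards [Metric.tendsto_nhds.1 (hg.1 t) (e / 3) (by linarith)] with s hs
    rw [Real.dist_eq] at hs ⊢
    have h1 := abs_le.1 (hfg s)
    have h2 := abs_le.1 (hfg t)
    rw [abs_lt] at hs ⊢
    constructor <;> linarith
  · intro t
    refine cauchy_map_iff_exists_tendsto.1 (Metric.cauchy_iff.2 ⟨inferInstance, fun e he => ?_⟩)
    obtain ⟨g, hg, hfg⟩ := h (e / 5) (by linarith)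
    obtain ⟨l, hl⟩ := hg.2 t
    refine ⟨f '' {s | dist (g s) l < e / 5},
      image_mem_map (Metric.tendsto_nhds.1 hl (e / 5) (by linarith)), ?_⟩
    rintro _ ⟨s, hs, rfl⟩ _ ⟨u, hu, rfl⟩
    simp only [mem_ofPred_eq, Real.dist_eq] at hs hu ⊢
    have h1 := abs_le.1 (hfg s)
    have h2 := abs_le.1 (hfg u)
    rw [abs_lt] at hs hu ⊢
    constructor <;> linarith

end IsCadlag

/-! ### The metric in terms of extended paths on the line. -/

namespace Cadlag

variable {T ε : ℝ}

/-- The extension of `x ∈ D([0, T])` to the line by `0` on the left and by `x T` on the right. -/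
noncomputable def lineExtend (hT : 0 < T) (x : Cadlag 0 T) (t : ℝ) : ℝ :=
  if t < 0 then 0 else x (projIcc 0 T hT.le t)

theorem lineExtend_of_neg (hT : 0 < T) (x : Cadlag 0 T) {t : ℝ} (ht : t < 0) :
    lineExtend hT x t = 0 := if_pos ht

theorem lineExtend_coe (hT : 0 < T) (x : Cadlag 0 T) (t : Icc 0 T) :
    lineExtend hT x t = x t := by
  simp [lineExtend, not_lt.2 t.2.1]

theorem lineExtend_of_le (hT : 0 < T) (x : Cadlag 0 T) {t : ℝ} (ht : T ≤ t) :
    lineExtend hT x t = lineExtend hT x T := by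
  simp [lineExtend, not_lt.2 hT.le, not_lt.2 (hT.le.trans ht), projIcc_of_right_le hT.le ht]

theorem lineExtend_isCadlag (hT : 0 < T) (x : Cadlag 0 T) : IsCadlag (lineExtend hT x) := by
  constructor
  · intro t
    by_cases ht : t < 0
    · refine (continuousWithinAt_const (b := (0 : ℝ))).congr_of_eventuallyEq ?_
        (lineExtend_of_neg hT x ht)
      filter_upwards [nhdsWithin_le_nhds (gt_mem_nhds ht)] with s hs
      exact lineExtend_of_neg hT x hs
    · have hp : ContinuousWithinAt (fun s : ℝ => x (projIcc 0 T hT.le s)) (Ici t) t :=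
        (x.right_cont _).comp (t := Ici (projIcc 0 T hT.le t))
          continuous_projIcc.continuousWithinAt fun s hs => monotone_projIcc hT.le hs
      refine hp.congr (fun s hs => if_neg ?_) (if_neg ht)
      have : t ≤ s := hs
      linarith
  · intro t
    rcases le_or_gt t 0 with ht | ht
    · refine ⟨0, tendsto_const_nhds.congr' ?_⟩
      filter_upwards [self_mem_nhdsWithin] with s hs
      exact (lineExtend_of_neg hT x (lt_of_lt_of_le hs ht)).symm
    rcases le_or_gt t T with htT | htT
    · obtain ⟨l, hl⟩ := x.left_lim (projIcc 0 T hT.le t)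
      refine ⟨l, (hl.comp (f := fun s : ℝ => projIcc 0 T hT.le s) (x := 𝓝[<] t) ?_).congr' ?_⟩
      · refine tendsto_nhdsWithin_iff.2
          ⟨(continuous_projIcc.tendsto t).mono_left nhdsWithin_le_nhds, ?_⟩
        filter_upwards [nhdsWithin_le_nhds (lt_mem_nhds ht), self_mem_nhdsWithin] with s hs hst
        have hst' : s < t := hst
        rw [mem_Iio, projIcc_of_mem hT.le ⟨hs.le, by linarith⟩, projIcc_of_mem hT.le ⟨ht.le, htT⟩]
        exact hst'
      · filter_upwards [nhdsWithin_le_nhds (lt_mem_nhds ht)] with s hs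
        exact (if_neg (not_lt.2 hs.le)).symm
    · refine ⟨lineExtend hT x T, tendsto_const_nhds.congr' ?_⟩
      filter_upwards [nhdsWithin_le_nhds (lt_mem_nhds htT)] with s hs
      exact (lineExtend_of_le hT x hs.le).symm

theorem exists_lineExtend_eq (hT : 0 < T) {f : ℝ → ℝ} (hf : IsCadlag f) (h0 : ∀ t < 0, f t = 0)
    (h1 : ∀ t, T ≤ t → f t = f T) : ∃ x : Cadlag 0 T, lineExtend hT x = f := by
  refine ⟨⟨fun t => f t, fun t => ?_, fun t => ?_⟩, ?_⟩
  · exact (hf.1 t).comp continuous_subtype_val.continuousWithinAt fun s hs => hs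
  · obtain ⟨l, hl⟩ := hf.2 t
    refine ⟨l, hl.comp (tendsto_nhdsWithin_iff.2
      ⟨(continuous_subtype_val.tendsto t).mono_left nhdsWithin_le_nhds, ?_⟩)⟩
    filter_upwards [self_mem_nhdsWithin] with s hs
    exact hs
  · funext t
    by_cases ht : t < 0
    · rw [lineExtend_of_neg hT _ ht, h0 t ht]
    rcases le_total t T with htT | htT
    · exact lineExtend_coe hT _ ⟨t, not_lt.1 ht, htT⟩
    · rw [lineExtend_of_le hT _ htT, h1 t htT]
      exact lineExtend_coe hT _ ⟨T, hT.le, le_rfl⟩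

theorem abs_log_div_le_iff {p q c : ℝ} (hp : 0 < p) (hq : 0 < q) :
    |Real.log (q / p)| ≤ c ↔ Real.exp (-c) * p ≤ q ∧ q ≤ Real.exp c * p := by
  have hd := div_pos hq hp
  rw [abs_le, Real.log_le_iff_le_exp hd, Real.le_log_iff_exp_le hd, div_le_iff₀ hp, le_div_iff₀ hp]

theorem skorokhodDist_extend_le (hT : 0 < T) {x y : Cadlag 0 T} {c : ℝ} (hc : 0 < c)
    {γ : ℝ → ℝ} (hγ : IsTimeChange c γ) (h1 : γ (-ε) = -ε) (h2 : γ (T + ε) = T + ε)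
    (h : ∀ t ∈ Icc (-ε) (T + ε), |lineExtend hT x t - lineExtend hT y (γ t)| ≤ c) :
    skorokhodDist (extend (ε := ε) hT x) (extend (ε := ε) hT y) ≤ c := by
  let g : Icc (-ε) (T + ε) → Icc (-ε) (T + ε) := fun t =>
    ⟨γ t, by simpa only [h1] using hγ.strictMono.monotone t.2.1,
      by simpa only [h2] using hγ.strictMono.monotone t.2.2⟩
  have hg : StrictMono g := fun s t hst => hγ.strictMono hst
  have hgs : Function.Surjective g := by
    intro t
    obtain ⟨s, hs⟩ := hγ.surjective t
    refine ⟨⟨s, ?_, ?_⟩, Subtype.ext hs⟩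
    · rw [← hγ.strictMono.le_iff_le, h1, hs]
      exact t.2.1
    · rw [← hγ.strictMono.le_iff_le, h2, hs]
      exact t.2.2
  refine skorokhodDist_le hc ⟨hg.orderIsoOfSurjective g hgs, fun s t hst => ?_, fun t => h t t.2⟩
  have hst' : (s : ℝ) < t := hst
  exact (abs_log_div_le_iff (sub_pos.2 hst') (sub_pos.2 (hγ.strictMono hst'))).2
    (hγ s t hst'.le)

/-- An order automorphism of a compact interval fixes its endpoints, so it continues by the
identity. The uniform bound persists beyond `T + ε` because both paths are constant from `T` on. -/
theorem exists_timeChange_of_skorokhodDist_lt (hT : 0 < T) (hε : 0 < ε) {x y : Cadlag 0 T} {c : ℝ}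
    (h : skorokhodDist (extend (ε := ε) hT x) (extend (ε := ε) hT y) < c) :
    ∃ γ : ℝ → ℝ, IsTimeChange c γ ∧ (∀ t, t ∉ Ioo (-ε) (T + ε) → γ t = t) ∧
      ∀ t, |lineExtend hT x t - lineExtend hT y (γ t)| ≤ c := by
  obtain ⟨c', hc', hc0, g, hg1, hg2⟩ := skorokhodClose_of_dist_lt h
  have hab : -ε ≤ T + ε := by linarith
  set P := projIcc (-ε) (T + ε) hab with hP
  have fixl : g ⟨-ε, le_rfl, hab⟩ = ⟨-ε, le_rfl, hab⟩ := by
    have : ∀ t : Icc (-ε) (T + ε), ⟨-ε, le_rfl, hab⟩ ≤ t := fun t => t.2.1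
    refine le_antisymm ?_ (this _)
    simpa using g.monotone (this (g.symm ⟨-ε, le_rfl, hab⟩))
  have fixr : g ⟨T + ε, hab, le_rfl⟩ = ⟨T + ε, hab, le_rfl⟩ := by
    have : ∀ t : Icc (-ε) (T + ε), t ≤ ⟨T + ε, hab, le_rfl⟩ := fun t => t.2.2
    refine le_antisymm (this _) ?_
    simpa using g.monotone (this (g.symm ⟨T + ε, hab, le_rfl⟩))
  have out : ∀ t, t ∉ Ioo (-ε) (T + ε) → (g (P t) : ℝ) + (t - P t) = t := by
    intro t ht
    rcases le_or_gt t (-ε) with h1 | h1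
    · rw [hP, projIcc_of_le_left hab h1, fixl]
      ring
    · have h2 : T + ε ≤ t := not_lt.1 fun h2 => ht ⟨h1, h2⟩
      rw [hP, projIcc_of_right_le hab h2, fixr]
      ring
  refine ⟨fun t => g (P t) + (t - P t), fun s t hst => ?_, out, fun t => ?_⟩
  · have hc : 0 < c := hc0.trans hc'
    have e1 : Real.exp (-c) ≤ 1 := Real.exp_le_one_iff.2 (by linarith)
    have e2 : 1 ≤ Real.exp c := Real.one_le_exp hc.le
    have hPm : P s ≤ P t := monotone_projIcc hab hst
    -- The part of the increment lying outside the interval is carried with slope `1`, which is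
    -- admissible as `exp (-c) ≤ 1 ≤ exp c`.
    have hr : 0 ≤ (t - P t) - (s - P s) := by
      simp only [hP, coe_projIcc]
      rcases max_cases (-ε) (min (T + ε) t) with ⟨h1, _⟩ | ⟨h1, _⟩ <;>
      rcases max_cases (-ε) (min (T + ε) s) with ⟨h2, _⟩ | ⟨h2, _⟩ <;>
      rcases min_cases (T + ε) t with ⟨h3, _⟩ | ⟨h3, _⟩ <;>
      rcases min_cases (T + ε) s with ⟨h4, _⟩ | ⟨h4, _⟩ <;> rw [h1, h2] <;> linarith
    have key : Real.exp (-c) * (P t - P s) ≤ g (P t) - g (P s) ∧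
        (g (P t) : ℝ) - g (P s) ≤ Real.exp c * (P t - P s) := by
      rcases hPm.eq_or_lt with he | hlt
      · simp [he]
      · have hlt' : (P s : ℝ) < P t := hlt
        have hglt : (g (P s) : ℝ) < g (P t) := g.strictMono hlt
        exact (abs_log_div_le_iff (sub_pos.2 hlt') (sub_pos.2 hglt)).1
          ((hg1 _ _ hlt).trans hc'.le)
    have m1 := mul_le_mul_of_nonneg_right e1 hr
    have m2 := mul_le_mul_of_nonneg_right e2 hr
    constructor <;> linarith [key.1, key.2]
  · by_cases ht : t ∈ Ioo (-ε) (T + ε)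
    · show |lineExtend hT x t - lineExtend hT y (g (P t) + (t - P t))| ≤ c
      have h1 := hg2 ⟨t, ht.1.le, ht.2.le⟩
      have h2 : P t = ⟨t, ht.1.le, ht.2.le⟩ := projIcc_of_mem hab _
      rw [h2, sub_self, add_zero]
      exact h1.trans hc'.le
    · show |lineExtend hT x t - lineExtend hT y (g (P t) + (t - P t))| ≤ c
      rw [out t ht]
      rcases le_or_gt t (-ε) with h1 | h1
      · rw [lineExtend_of_neg hT _ (by linarith), lineExtend_of_neg hT _ (by linarith)]
        simpa using (hc0.trans hc').le
      · have h2 : T + ε ≤ t := not_lt.1 fun h2 => ht ⟨h1, h2⟩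
        have h3 := hg2 ⟨T + ε, hab, le_rfl⟩
        rw [fixr] at h3
        have h4 : |lineExtend hT x (T + ε) - lineExtend hT y (T + ε)| ≤ c' := h3
        rw [lineExtend_of_le hT _ (by linarith : T ≤ T + ε),
          lineExtend_of_le hT _ (by linarith : T ≤ T + ε)] at h4
        rw [lineExtend_of_le hT _ (by linarith : T ≤ t),
          lineExtend_of_le hT _ (by linarith : T ≤ t)]
        exact h4.trans hc'.le

end Cadlag

/-! ### Infinite compositions of time changes, and completeness. -/

theorem tendsto_two_mul_half_pow : Tendsto (fun n : ℕ => 2 * (1 / 2 : ℝ) ^ n) atTop (𝓝 0) := by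
  simpa using (tendsto_pow_atTop_nhds_zero_of_lt_one (r := (1 / 2 : ℝ)) (by norm_num)
    (by norm_num)).const_mul 2

/-- The compositions `γ m ∘ ⋯ ∘ γ n` converge as `m → ∞`. -/
theorem IsTimeChange.exists_infinite_comp {a b : ℝ} (hab : a ≤ b) {γ : ℕ → ℝ → ℝ}
    (hγ : ∀ n, IsTimeChange ((1 / 2) ^ n) (γ n)) (hγo : ∀ n t, t ∉ Ioo a b → γ n t = t) :
    ∃ A : ℕ → ℝ → ℝ, (∀ n, IsTimeChange (2 * (1 / 2) ^ n) (A n)) ∧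
      (∀ n t, t ∉ Ioo a b → A n t = t) ∧ (∀ n t, A (n + 1) t = γ n (A n t)) ∧
      ∀ t, Tendsto (fun n => A n t) atTop (𝓝 t) := by
  let G : ℕ → ℝ → ℝ := fun n => Nat.rec id (fun k g => γ k ∘ g) n
  have G0 : ∀ t, G 0 t = t := fun t => rfl
  have Gs : ∀ n t, G (n + 1) t = γ n (G n t) := fun n t => rfl
  have Gmono : ∀ n, Monotone (G n) := by
    intro n
    induction n with
    | zero => exact monotone_id
    | succ n ih => exact (hγ n).strictMono.monotone.comp ih
  have Gfix : ∀ n t, t ∉ Ioo a b → G n t = t := by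
    intro n t ht
    induction n with
    | zero => rfl
    | succ n ih => rw [Gs, ih, hγo n t ht]
  -- The exponent is the geometric sum of `(1/2)^i` over `n ≤ i < n + k`.
  have Gest : ∀ n k s t, s ≤ t →
      Real.exp (-(2 * (1 / 2) ^ n - 2 * (1 / 2) ^ (n + k))) * (G n t - G n s) ≤
        G (n + k) t - G (n + k) s ∧
      G (n + k) t - G (n + k) s ≤
        Real.exp (2 * (1 / 2) ^ n - 2 * (1 / 2) ^ (n + k)) * (G n t - G n s) := by
    intro n k s t hst
    induction k with
    | zero => simp
    | succ k ih =>
      obtain ⟨h1, h2⟩ := hγ (n + k) _ _ (Gmono (n + k) hst)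
      have e : 2 * (1 / 2 : ℝ) ^ n - 2 * (1 / 2) ^ (n + (k + 1)) =
          (1 / 2) ^ (n + k) + (2 * (1 / 2) ^ n - 2 * (1 / 2) ^ (n + k)) := by
        rw [← add_assoc, pow_succ]
        ring
      rw [e, neg_add, Real.exp_add, Real.exp_add, mul_assoc, mul_assoc, ← add_assoc, Gs, Gs]
      exact ⟨(mul_le_mul_of_nonneg_left ih.1 (Real.exp_pos _).le).trans h1,
        h2.trans (mul_le_mul_of_nonneg_left ih.2 (Real.exp_pos _).le)⟩
  have Gcauchy : ∀ t, CauchySeq fun n => G n t := by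
    intro t
    refine cauchySeq_of_le_geometric (1 / 2) (2 * (b - a)) (by norm_num) fun n => ?_
    rw [Gs, dist_comm, Real.dist_eq]
    exact (hγ n).abs_sub_self_le hab (by positivity) (pow_le_one₀ (by norm_num) (by norm_num))
      (hγo n) _
  choose L hL using fun t => cauchySeq_tendsto_of_complete (Gcauchy t)
  have r0 : ∀ n : ℕ, Tendsto (fun k : ℕ => 2 * (1 / 2 : ℝ) ^ n - 2 * (1 / 2) ^ (n + k)) atTop
      (𝓝 (2 * (1 / 2 : ℝ) ^ n)) := by
    intro n
    have h1 := tendsto_two_mul_half_pow.comp (tendsto_add_atTop_nat n)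
    simpa [Function.comp_def, add_comm n] using h1.const_sub (2 * (1 / 2 : ℝ) ^ n)
  have Lest : ∀ n s t, s ≤ t →
      Real.exp (-(2 * (1 / 2) ^ n)) * (G n t - G n s) ≤ L t - L s ∧
      L t - L s ≤ Real.exp (2 * (1 / 2) ^ n) * (G n t - G n s) := by
    intro n s t hst
    have hl : Tendsto (fun k => G (n + k) t - G (n + k) s) atTop (𝓝 (L t - L s)) := by
      have := ((hL t).sub (hL s)).comp (tendsto_add_atTop_nat n)
      simpa [Function.comp_def, add_comm n] using this
    refine ⟨le_of_tendsto_of_tendsto' (((Real.continuous_exp.tendsto _).comp (r0 n).neg).mul_const _)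
      hl fun k => (Gest n k s t hst).1, le_of_tendsto_of_tendsto' hl
      (((Real.continuous_exp.tendsto _).comp (r0 n)).mul_const _) fun k => (Gest n k s t hst).2⟩
  have Lchange : IsTimeChange 2 L := by
    intro s t hst
    simpa [G0] using Lest 0 s t hst
  have Lfix : ∀ t, t ∉ Ioo a b → L t = t := by
    intro t ht
    refine tendsto_nhds_unique (hL t) (tendsto_const_nhds.congr fun n => (Gfix n t ht).symm)
  obtain ⟨H, hH, hHl, hHr⟩ := Lchange.exists_inverse
  -- `A n = G n ∘ L⁻¹` is the inverse of the infinite composition of the `γ m` with `m ≥ n`. `Lest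
  -- n` compares the increments of `L` and `G n`, which yields its slope bound.
  refine ⟨fun n t => G n (H t), fun n s t hst => ?_, fun n t ht => ?_, fun n t => Gs n _,
    fun t => by simpa only [hHr t] using hL (H t)⟩
  · obtain ⟨h1, h2⟩ := Lest n _ _ (hH.strictMono.monotone hst)
    rw [hHr, hHr] at h1 h2
    have hmul : Real.exp (-(2 * (1 / 2 : ℝ) ^ n)) * Real.exp (2 * (1 / 2) ^ n) = 1 := by
      rw [← Real.exp_add]
      simp
    constructor
    · have := mul_le_mul_of_nonneg_left h2 (Real.exp_pos (-(2 * (1 / 2) ^ n))).le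
      rwa [← mul_assoc, hmul, one_mul] at this
    · have := mul_le_mul_of_nonneg_left h1 (Real.exp_pos (2 * (1 / 2) ^ n)).le
      rwa [← mul_assoc, mul_comm (Real.exp (2 * _)), hmul, one_mul] at this
  · have : H t = t := by
      conv_lhs => rw [← Lfix t ht]
      exact hHl t
    simp only [this]
    exact Gfix n t ht

namespace Cadlag

variable {T ε : ℝ}

theorem mJ1_completeSpace (hT : 0 < T) (hε : 0 < ε) :
    letI : MetricSpace (Cadlag 0 T) := mJ1MetricSpace hT hε
    CompleteSpace (Cadlag 0 T) := by
  let _ : MetricSpace (Cadlag 0 T) := mJ1MetricSpace hT hε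
  refine Metric.complete_of_convergent_controlled_sequences (fun n => (1 / 2) ^ n)
    (fun n => by positivity) fun u hu => ?_
  choose γ hγ hγo hγd using fun n : ℕ => exists_timeChange_of_skorokhodDist_lt (x := u n)
    (y := u (n + 1)) hT hε (hu n n (n + 1) le_rfl n.le_succ)
  obtain ⟨A, hA, hAo, hAs, hAl⟩ :=
    IsTimeChange.exists_infinite_comp (by linarith : -ε ≤ T + ε) hγ hγo
  have step : ∀ t n, dist (lineExtend hT (u n) (A n t)) (lineExtend hT (u (n + 1)) (A (n + 1) t)) ≤
      1 * (1 / 2) ^ n := by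
    intro t n
    rw [Real.dist_eq, hAs, one_mul]
    exact hγd n (A n t)
  choose f hf using fun t => cauchySeq_tendsto_of_complete
    (cauchySeq_of_le_geometric (1 / 2) 1 (by norm_num) (step t))
  have hfA : ∀ n t, |lineExtend hT (u n) (A n t) - f t| ≤ 2 * (1 / 2) ^ n := by
    intro n t
    have := dist_le_of_le_geometric_of_tendsto (1 / 2) 1 (by norm_num) (step t) (hf t) n
    rw [Real.dist_eq] at this
    refine this.trans (le_of_eq ?_)
    norm_num
    ring
  have fcad : IsCadlag f := by
    refine IsCadlag.of_uniform_approx fun e he => ?_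
    obtain ⟨n, hn⟩ := (tendsto_two_mul_half_pow.eventually (gt_mem_nhds he)).exists
    refine ⟨_, (lineExtend_isCadlag hT (u n)).comp_strictMono (hA n).strictMono (hA n).continuous,
      fun t => ?_⟩
    rw [abs_sub_comm]
    exact (hfA n t).trans hn.le
  have fneg : ∀ t < 0, f t = 0 := by
    intro t ht
    refine tendsto_nhds_unique (hf t) (tendsto_const_nhds.congr' ?_)
    filter_upwards [(hAl t).eventually (gt_mem_nhds ht)] with n hn
    exact (lineExtend_of_neg hT _ hn).symm
  -- Strict inequalities are needed here, as `A n T` may lie left of `T`; the point `T` itself is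
  -- recovered by right-continuity.
  have fright' : ∀ s t, T < s → T < t → f s = f t := by
    intro s t hs ht
    refine tendsto_nhds_unique (hf s) ((hf t).congr' ?_)
    filter_upwards [(hAl t).eventually (lt_mem_nhds ht), (hAl s).eventually (lt_mem_nhds hs)]
      with n hn hn'
    rw [lineExtend_of_le hT _ hn.le, lineExtend_of_le hT _ hn'.le]
  have fright : ∀ t, T ≤ t → f t = f T := by
    intro t ht
    rcases ht.eq_or_lt with rfl | ht
    · rfl
    have h1 : Tendsto f (𝓝[>] T) (𝓝 (f T)) :=
      (fcad.1 T).tendsto.mono_left (nhdsWithin_mono _ Ioi_subset_Ici_self)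
    refine tendsto_nhds_unique (tendsto_const_nhds.congr' ?_) h1
    filter_upwards [self_mem_nhdsWithin] with s hs
    exact fright' t s ht hs
  obtain ⟨x, rfl⟩ := exists_lineExtend_eq hT fcad fneg fright
  refine ⟨x, tendsto_iff_dist_tendsto_zero.2 (squeeze_zero (fun _ => dist_nonneg) (fun n => ?_)
    tendsto_two_mul_half_pow)⟩
  rw [dist_comm]
  refine skorokhodDist_extend_le hT (by positivity) (hA n) (hAo n _ (by simp)) (hAo n _ (by simp))
    fun t _ => ?_
  rw [abs_sub_comm]
  exact hfA n t

end Cadlag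

/-! ### The three-point modulus. -/

/-- Among any three points `s < t < u` of a window of length less than `δ`, the middle value is
within `e` of one of the outer values. -/
def WindowSmall (f : ℝ → ℝ) (δ e : ℝ) : Prop :=
  ∀ s t u, s < t → t < u → u - s < δ → min |f t - f s| |f u - f t| ≤ e

namespace WindowSmall

variable {f g : ℝ → ℝ} {δ δ' e c : ℝ}

theorem anti (h : WindowSmall f δ e) (hδ : δ' ≤ δ) : WindowSmall f δ' e :=
  fun s t u hst htu hus => h s t u hst htu (hus.trans_le hδ)

theorem comp_timeChange (h : WindowSmall f δ e) {γ : ℝ → ℝ} (hγ : IsTimeChange c γ)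
    (hfg : ∀ t, |f t - g (γ t)| ≤ c) : WindowSmall g (Real.exp (-c) * δ) (e + 2 * c) := by
  intro s t u hst htu hus
  obtain ⟨s, rfl⟩ := hγ.surjective s
  obtain ⟨t, rfl⟩ := hγ.surjective t
  obtain ⟨u, rfl⟩ := hγ.surjective u
  rw [hγ.strictMono.lt_iff_lt] at hst htu
  have h1 : u - s < δ := by
    have := (hγ s u (hst.trans htu).le).1.trans_lt hus
    exact lt_of_mul_lt_mul_left this (Real.exp_pos _).le
  have hs := hfg s
  have ht := hfg t
  have hu := hfg u
  have key : ∀ p q r w : ℝ, |p - q| ≤ c → |r - w| ≤ c → |q - w| ≤ |p - r| + 2 * c := by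
    intro p q r w h1 h2
    have h3 : q - w = (p - r) + ((q - p) + (r - w)) := by ring
    rw [h3]
    have h4 := abs_add_le (p - r) ((q - p) + (r - w))
    have h5 := abs_add_le (q - p) (r - w)
    rw [abs_sub_comm q p] at h5
    linarith
  rcases min_le_iff.1 (h s t u hst htu h1) with h2 | h2
  · exact (min_le_left _ _).trans ((key _ _ _ _ ht hs).trans (by linarith))
  · exact (min_le_right _ _).trans ((key _ _ _ _ hu ht).trans (by linarith))

/-- Take for `τ` the first time `f` leaves the `e`-band around `f p`. If a later `v` were more than
`e` from `f τ`, right-continuity would give an exit time `w < v` at or just after `τ` with `f w`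
more than `e` from both `f p` and `f v`, against the three-point condition. -/
theorem exists_split (h : WindowSmall f δ e) (he : 0 ≤ e)
    (hf : ∀ t, ContinuousWithinAt f (Ici t) t) (p : ℝ) :
    ∃ τ, p ≤ τ ∧ (∀ v ∈ Ico p τ, |f v - f p| ≤ e) ∧ ∀ v ∈ Ico τ (p + δ), |f v - f τ| ≤ e := by
  let S := {v | v ∈ Ico p (p + δ) ∧ e < |f v - f p|}
  rcases S.eq_empty_or_nonempty with hS | hS
  · refine ⟨p, le_rfl, by simp, fun v hv => not_lt.1 fun hlt => ?_⟩
    exact (hS ▸ (⟨hv, hlt⟩ : v ∈ S) : v ∈ (∅ : Set ℝ))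
  have hbdd : BddBelow S := ⟨p, fun v hv => hv.1.1⟩
  obtain ⟨v₀, hv₀⟩ := hS
  have hτ : sInf S ≤ v₀ := csInf_le hbdd hv₀
  refine ⟨sInf S, le_csInf ⟨v₀, hv₀⟩ fun v hv => hv.1.1, fun v hv => not_lt.1 fun hlt => ?_,
    fun v hv => not_lt.1 fun hlt => ?_⟩
  · exact (csInf_le hbdd (⟨⟨hv.1, hv.2.trans (hτ.trans_lt hv₀.1.2)⟩, hlt⟩ : v ∈ S)).not_gt hv.2
  · have hv1 : sInf S < v := by
      refine hv.1.lt_of_ne fun heq => ?_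
      rw [← heq, sub_self, abs_zero] at hlt
      linarith
    have h1 : Tendsto (fun w => |f v - f w|) (𝓝[≥] sInf S) (𝓝 |f v - f (sInf S)|) :=
      ((hf (sInf S)).tendsto.const_sub (f v)).abs
    have h2 := h1.eventually (lt_mem_nhds hlt)
    obtain ⟨r, hr, hrS⟩ := Metric.mem_nhdsWithin_iff.1 h2
    obtain ⟨w, hw, hwlt⟩ := exists_lt_of_csInf_lt ⟨v₀, hv₀⟩
      (lt_min hv1 (lt_add_of_pos_right (sInf S) hr))
    have hτw : sInf S ≤ w := csInf_le hbdd hw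
    have hw2 : e < |f v - f w| := by
      refine hrS ⟨?_, hτw⟩
      rw [Metric.mem_ball, Real.dist_eq, abs_of_nonneg (sub_nonneg.2 hτw)]
      linarith [hwlt.trans_le (min_le_right _ _)]
    have hpw : p < w := by
      refine hw.1.1.lt_of_ne fun heq => ?_
      have := hw.2
      rw [← heq, sub_self, abs_zero] at this
      linarith
    have := h p w v hpw (hwlt.trans_le (min_le_left _ _)) (by linarith [hv.2])
    exact this.not_gt (lt_min hw.2 hw2)

/-- Split from `t + δ / 4`, which forces a minimal gap. If the split time is at most `t + 3 * (δ /
4)`, cut there; otherwise `t + δ / 4` already starts a quiet stretch of length `δ / 2`. Quietness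
after the new cut is the invariant that lets the step be iterated. -/
theorem exists_next (h : WindowSmall f δ e) (hδ : 0 < δ) (he : 0 ≤ e)
    (hf : ∀ t, ContinuousWithinAt f (Ici t) t) {t : ℝ}
    (ht : ∀ v ∈ Ico t (t + δ / 2), |f v - f t| ≤ e) :
    ∃ t', t + δ / 4 ≤ t' ∧ t' ≤ t + 3 * (δ / 4) ∧ (∀ v ∈ Ico t t', |f v - f t| ≤ 2 * e) ∧
      ∀ v ∈ Ico t' (t' + δ / 2), |f v - f t'| ≤ e := by
  obtain ⟨τ, hτ, h1, h2⟩ := h.exists_split he hf (t + δ / 4)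
  rcases le_or_gt τ (t + δ / 4 + δ / 2) with hc | hc
  · refine ⟨τ, hτ, by linarith, fun v hv => ?_, fun v hv => h2 v ⟨hv.1, by linarith [hv.2]⟩⟩
    rcases lt_or_ge v (t + δ / 4) with hv' | hv'
    · exact (ht v ⟨hv.1, by linarith⟩).trans (by linarith)
    · have h3 := h1 v ⟨hv', hv.2⟩
      have h4 := ht (t + δ / 4) ⟨by linarith, by linarith⟩
      have := abs_sub_le (f v) (f (t + δ / 4)) (f t)
      linarith
  · refine ⟨t + δ / 4, le_rfl, by linarith, fun v hv => ?_, fun v hv => h1 v ⟨hv.1, by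
      linarith [hv.2]⟩⟩
    exact (ht v ⟨hv.1, by linarith [hv.2]⟩).trans (by linarith)

end WindowSmall

/-- Around each point `i`, one-sided limits make `f` oscillate by at most `e` on each side of `i`.
By a Lebesgue number, a short window lies in one such neighbourhood, and its middle point is on the
same side of `i` as one of the outer points. -/
theorem IsCadlag.exists_windowSmall {f : ℝ → ℝ} (hf : IsCadlag f) {a b : ℝ}
    (ha : ∀ s < a, ∀ t < a, f s = f t) (hb : ∀ s ≥ b, ∀ t ≥ b, f s = f t) {e : ℝ} (he : 0 < e) :
    ∃ δ > 0, WindowSmall f δ e := by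
  have loc : ∀ t, ∃ r > 0, (∀ s ∈ Metric.ball t r, ∀ u ∈ Metric.ball t r, s < t → u < t →
      |f s - f u| ≤ e) ∧ ∀ s ∈ Metric.ball t r, ∀ u ∈ Metric.ball t r, t ≤ s → t ≤ u →
      |f s - f u| ≤ e := by
    intro t
    have tri : ∀ p q l : ℝ, dist p l < e / 2 → dist q l < e / 2 → |p - q| ≤ e := by
      intro p q l h1 h2
      rw [Real.dist_eq, abs_lt] at h1 h2
      rw [abs_le]
      constructor <;> linarith
    obtain ⟨l, hl⟩ := hf.2 t
    obtain ⟨r, hr, h1⟩ := Metric.mem_nhdsWithin_iff.1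
      (Metric.tendsto_nhds.1 hl (e / 2) (by linarith))
    obtain ⟨r', hr', h2⟩ := Metric.mem_nhdsWithin_iff.1
      (Metric.tendsto_nhds.1 (hf.1 t) (e / 2) (by linarith))
    have b1 := Metric.ball_subset_ball (x := t) (min_le_left r r')
    have b2 := Metric.ball_subset_ball (x := t) (min_le_right r r')
    exact ⟨min r r', lt_min hr hr',
      fun s hs u hu hst hut => tri _ _ l (h1 ⟨b1 hs, hst⟩) (h1 ⟨b1 hu, hut⟩),
      fun s hs u hu hst hut => tri _ _ (f t) (h2 ⟨b2 hs, hst⟩) (h2 ⟨b2 hu, hut⟩)⟩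
  choose r hr hl hrt using loc
  obtain ⟨δ, hδ, hδc⟩ := lebesgue_number_lemma_of_metric (isCompact_Icc (a := a - 1) (b := b))
    (c := fun t => Metric.ball t (r t)) (fun t => Metric.isOpen_ball)
    fun t _ => mem_iUnion.2 ⟨t, Metric.mem_ball_self (hr t)⟩
  -- The bound `1` keeps a window starting before `a - 1` inside the region left of `a`, where `f`
  -- is constant.
  refine ⟨min δ 1, lt_min hδ one_pos, fun s t u hst htu hus => ?_⟩
  have hus1 := hus.trans_le (min_le_left _ _)
  have hus2 := hus.trans_le (min_le_right _ _)
  rcases lt_or_ge s (a - 1) with hs | hs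
  · refine (min_le_left _ _).trans ?_
    rw [ha t (by linarith) s (by linarith), sub_self, abs_zero]
    exact he.le
  rcases lt_or_ge b s with hs' | hs'
  · refine (min_le_left _ _).trans ?_
    rw [hb t (by linarith) s (by linarith), sub_self, abs_zero]
    exact he.le
  obtain ⟨i, hi⟩ := hδc s ⟨hs, hs'⟩
  have mem : ∀ v, s ≤ v → v ≤ u → v ∈ Metric.ball i (r i) := by
    intro v h1 h2
    refine hi ?_
    rw [Metric.mem_ball, Real.dist_eq, abs_of_nonneg (by linarith)]
    linarith
  rcases lt_or_ge t i with hti | hti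
  · exact (min_le_left _ _).trans
      (hl i t (mem t hst.le htu.le) s (mem s le_rfl (hst.trans htu).le) hti (hst.trans hti))
  · exact (min_le_right _ _).trans (hrt i u (mem u (hst.trans htu).le le_rfl) t
      (mem t hst.le htu.le) (hti.trans htu.le) hti)

/-! ### Partitions with small oscillation, and their matching. -/

/-- `OscPartition f η o b t L`: the list `L` cuts `[t, b]` into intervals of length at least `η`,
and on each of them `f` stays within `o` of its value at the left end; on the last one this
holds up to infinity. -/
inductive OscPartition (f : ℝ → ℝ) (η o b : ℝ) : ℝ → List ℝ → Prop
  | nil {t : ℝ} (hgap : t + η ≤ b) (hosc : ∀ v, t ≤ v → |f v - f t| ≤ o) :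
      OscPartition f η o b t []
  | cons {t t' : ℝ} {L : List ℝ} (hgap : t + η ≤ t') (hosc : ∀ v ∈ Ico t t', |f v - f t| ≤ o)
      (htail : OscPartition f η o b t' L) : OscPartition f η o b t (t' :: L)

theorem OscPartition.le {f : ℝ → ℝ} {η o b t : ℝ} {L : List ℝ} (hη : 0 < η)
    (h : OscPartition f η o b t L) : t ≤ b := by
  induction h with
  | nil hgap _ => linarith
  | cons hgap _ _ ih => linarith

theorem WindowSmall.exists_oscPartition {f : ℝ → ℝ} {δ e T b : ℝ} (h : WindowSmall f δ e)
    (hδ : 0 < δ) (he : 0 ≤ e) (hf : ∀ t, ContinuousWithinAt f (Ici t) t)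
    (hT : ∀ t, T ≤ t → f t = f T) (hb : T + δ ≤ b) (n : ℕ) : ∀ t : ℝ, T ≤ t + n * (δ / 4) →
    t ≤ T + 3 * (δ / 4) → (∀ v ∈ Ico t (t + δ / 2), |f v - f t| ≤ e) →
    ∃ L : List ℝ, L.length ≤ n ∧ OscPartition f (δ / 4) (2 * e) b t L ∧
      ∀ p ∈ L, p ∈ Icc t b := by
  -- A cut made from before `T` overshoots it by at most `3 * (δ / 4)`, so `T + δ ≤ b` leaves room
  -- for a last gap of `δ / 4`.
  have past_end : ∀ t, T ≤ t → t ≤ T + 3 * (δ / 4) → OscPartition f (δ / 4) (2 * e) b t [] := by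
    intro t h1 h2
    refine .nil (by linarith) fun v hv => ?_
    rw [hT v (h1.trans hv), hT t h1, sub_self, abs_zero]
    linarith
  induction n with
  | zero =>
    intro t h1 h2 _
    exact ⟨[], le_rfl, past_end t (by simpa using h1) h2, by simp⟩
  | succ n ih =>
    intro t h1 h2 h3
    rcases le_or_gt T t with htT | htT
    · exact ⟨[], by simp, past_end t htT h2, by simp⟩
    obtain ⟨t', h4, h5, h6, h7⟩ := h.exists_next hδ he hf h3
    push_cast at h1
    obtain ⟨L, hL1, hL2, hL3⟩ := ih t' (by linarith) (by linarith) h7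
    refine ⟨t' :: L, by simpa using hL1, .cons h4 h6 hL2, fun p hp => ?_⟩
    rcases List.mem_cons.1 hp with rfl | hp
    · exact ⟨by linarith, by linarith⟩
    · exact ⟨by linarith [(hL3 p hp).1], (hL3 p hp).2⟩

theorem isTimeChange_affine {c q : ℝ} (h1 : Real.exp (-c) ≤ q) (h2 : q ≤ Real.exp c)
    (t t' : ℝ) : IsTimeChange c fun v => t' + q * (v - t) := by
  intro s u hsu
  have m1 := mul_le_mul_of_nonneg_right h1 (sub_nonneg.2 hsu)
  have m2 := mul_le_mul_of_nonneg_right h2 (sub_nonneg.2 hsu)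
  constructor <;> simp only <;> linarith

theorem IsTimeChange.glue {c p : ℝ} {α β : ℝ → ℝ} (hα : IsTimeChange c α)
    (hβ : IsTimeChange c β) (hp : α p = β p) :
    IsTimeChange c fun v => if v < p then α v else β v := by
  intro s t hst
  rcases lt_or_ge t p with ht | ht
  · simpa only [if_pos ht, if_pos (hst.trans_lt ht)] using hα s t hst
  rcases lt_or_ge s p with hs | hs
  · simp only [if_neg ht.not_gt, if_pos hs]
    have h1 := hα s p hs.le
    have h2 := hβ p t ht
    constructor <;> linarith [h1.1, h1.2, h2.1, h2.2]
  · simpa only [if_neg ht.not_gt, if_neg hs.not_gt] using hβ s t hst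

/-- Moving each endpoint by at most `e * η / 2` changes a length that is at least `η` by a factor of
at most `1 + e ≤ exp e`, in either direction. -/
theorem exists_slope {e η t t₁ t' t₁' : ℝ} (he : 0 < e) (h1 : t + η ≤ t₁)
    (h2 : t' + η ≤ t₁') (hη : 0 < η) (ht : |t - t'| ≤ e * η / 2) (ht₁ : |t₁ - t₁'| ≤ e * η / 2) :
    ∃ q, Real.exp (-e) ≤ q ∧ q ≤ Real.exp e ∧ t' + q * (t₁ - t) = t₁' := by
  have hp : 0 < t₁ - t := by linarith
  have hp' : 0 < t₁' - t' := by linarith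
  have hexp := Real.add_one_le_exp e
  have aux : ∀ x y : ℝ, η ≤ x → y ≤ x + e * η → y ≤ Real.exp e * x := by
    intro x y hx hy
    have m1 := mul_le_mul_of_nonneg_left hx he.le
    have m2 := mul_le_mul_of_nonneg_right hexp (hη.le.trans hx)
    linarith
  rw [abs_le] at ht ht₁
  refine ⟨(t₁' - t') / (t₁ - t), ?_, ?_, ?_⟩
  · rw [le_div_iff₀ hp, Real.exp_neg, inv_mul_le_iff₀ (Real.exp_pos e)]
    exact aux _ _ (by linarith) (by linarith [ht.1, ht.2, ht₁.1, ht₁.2])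
  · rw [div_le_iff₀ hp]
    exact aux _ _ (by linarith) (by linarith [ht.1, ht.2, ht₁.1, ht₁.2])
  · rw [div_mul_cancel₀ _ hp.ne']
    ring

theorem abs_sub_le_of_floor_div_eq {m x y : ℝ} (hm : 0 < m) (h : ⌊x / m⌋ = ⌊y / m⌋) :
    |x - y| ≤ m := by
  have h1 := (Int.abs_sub_lt_one_of_floor_eq_floor h).le
  rwa [← sub_div, abs_div, abs_of_pos hm, div_le_one hm] at h1

/-- Equal codes force equally many cuts at nearby places, so mapping pieces affinely onto pieces
gives slopes in `[exp (-e), exp e]`. On matched pieces the error is `o` for each function plus `e`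
for the rounded values. -/
theorem OscPartition.exists_timeChange {f g : ℝ → ℝ} {η o b e t t' : ℝ} {L L' : List ℝ}
    (hη : 0 < η) (he : 0 < e) (h : OscPartition f η o b t L) (h' : OscPartition g η o b t' L')
    (hcode : (t :: L).map (fun p => (⌊p / (e * η / 2)⌋, ⌊f p / e⌋)) =
      (t' :: L').map fun p => (⌊p / (e * η / 2)⌋, ⌊g p / e⌋)) :
    ∃ γ : ℝ → ℝ, IsTimeChange e γ ∧ γ t = t' ∧ γ b = b ∧
      ∀ v, t ≤ v → |f v - g (γ v)| ≤ 2 * o + e := by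
  have hm : 0 < e * η / 2 := by positivity
  have close : ∀ {t v t' v' : ℝ}, ⌊f t / e⌋ = ⌊g t' / e⌋ → |f v - f t| ≤ o →
      |g v' - g t'| ≤ o → |f v - g v'| ≤ 2 * o + e := by
    intro t v t' v' h1 h2 h3
    have h4 := abs_sub_le_of_floor_div_eq he h1
    rw [abs_le] at *
    constructor <;> linarith
  induction h generalizing t' L' with
  | @nil t hgap hosc =>
    cases h' with
    | cons => simp at hcode
    | nil hgap' hosc' =>
      simp only [List.map_cons, List.map_nil, List.cons.injEq, Prod.mk.injEq, and_true] at hcode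
      obtain ⟨q, hq1, hq2, hq3⟩ := exists_slope he hgap hgap' hη
        (abs_sub_le_of_floor_div_eq hm hcode.1) (by simpa using hm.le)
      refine ⟨_, isTimeChange_affine hq1 hq2 t t', by simp, hq3, fun v hv => ?_⟩
      refine close hcode.2 (hosc v hv) (hosc' _ ?_)
      have := mul_nonneg ((Real.exp_pos _).le.trans hq1) (sub_nonneg.2 hv)
      linarith
  | @cons t t₁ L hgap hosc htail ih =>
    cases h' with
    | nil => simp at hcode
    | @cons _ t₁' L' hgap' hosc' htail' =>
      rw [List.map_cons, List.map_cons (a := t'), List.cons.injEq, Prod.mk.injEq] at hcode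
      obtain ⟨⟨hc1, hc2⟩, hc3⟩ := hcode
      obtain ⟨γ, hγ, hγt, hγb, hγd⟩ := ih htail' hc3
      simp only [List.map_cons, List.cons.injEq, Prod.mk.injEq] at hc3
      obtain ⟨q, hq1, hq2, hq3⟩ := exists_slope he hgap hgap' hη
        (abs_sub_le_of_floor_div_eq hm hc1) (abs_sub_le_of_floor_div_eq hm hc3.1.1)
      have haff := isTimeChange_affine hq1 hq2 t t'
      have hb := htail.le hη
      refine ⟨_, haff.glue hγ (hq3.trans hγt.symm), ?_, ?_, fun v hv => ?_⟩
      · rw [if_pos (by linarith)]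
        simp
      · rw [if_neg hb.not_gt, hγb]
      · rcases lt_or_ge v t₁ with hv' | hv'
        · simp only [if_pos hv']
          refine close hc2 (hosc v ⟨hv, hv'⟩) (hosc' _ ⟨?_, ?_⟩)
          · have := mul_nonneg ((Real.exp_pos _).le.trans hq1) (sub_nonneg.2 hv)
            linarith
          · rw [← hq3]
            exact haff.strictMono hv'
        · simp only [if_neg hv'.not_gt]
          exact hγd v hv'

/-! ### Moduli and partitions of extended paths. -/

namespace Cadlag

variable {T ε : ℝ}

/-- The time `0-` stands for all negative times, and `u` may be cut down to `T`. Windows whose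
middle point is outside `[0, T)` contribute nothing. -/
theorem mJ1Modulus_le_iff (hT : 0 < T) {x : Cadlag 0 T} {δ e : ℝ} (he : 0 ≤ e) :
    mJ1Modulus x δ ≤ ENNReal.ofReal e ↔ WindowSmall (lineExtend hT x) δ e := by
  simp only [mJ1Modulus, iSup_le_iff, ENNReal.ofReal_le_ofReal_iff he]
  constructor
  · intro h s t u hst htu hus
    rcases lt_or_ge t 0 with ht | ht
    · refine (min_le_left _ _).trans ?_
      simpa [lineExtend_of_neg hT x ht, lineExtend_of_neg hT x (hst.trans ht)] using he
    rcases le_or_gt T t with htT | htT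
    · refine (min_le_right _ _).trans ?_
      simpa [lineExtend_of_le hT x htT, lineExtend_of_le hT x (htT.trans htu.le)] using he
    let t' : Icc 0 T := ⟨t, ht, htT.le⟩
    let u' : Icc 0 T := ⟨min u T, le_min (ht.trans htu.le) hT.le, min_le_right _ _⟩
    have htu' : t' < u' := lt_min htu htT
    have hxt : lineExtend hT x t = x t' := lineExtend_coe hT x t'
    have hxu : lineExtend hT x u = x u' := by
      rw [← lineExtend_coe hT x u']
      show lineExtend hT x u = lineExtend hT x (min u T)
      rcases le_total u T with hu | hu
      · rw [min_eq_left hu]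
      · rw [min_eq_right hu, lineExtend_of_le hT x hu]
    have hu' : (u' : ℝ) ≤ u := min_le_left _ _
    rw [hxt, hxu]
    rcases lt_or_ge s 0 with hs | hs
    · rw [lineExtend_of_neg hT x hs]
      exact h ⊥ t' u' ⟨WithBot.bot_lt_coe _, htu', show (u' : ℝ) < δ by linarith⟩
    · let s' : Icc 0 T := ⟨s, hs, (hst.trans htT).le⟩
      have hxs : lineExtend hT x s = x s' := lineExtend_coe hT x s'
      rw [hxs]
      exact h s' t' u' ⟨WithBot.coe_lt_coe.2 hst, htu', show (u' : ℝ) - s < δ by linarith⟩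
  · intro h s t u hstu
    obtain ⟨hst, htu, hus⟩ := hstu
    rw [← lineExtend_coe hT x t, ← lineExtend_coe hT x u]
    have htu' : (t : ℝ) < u := htu
    induction s using WithBot.recBotCoe with
    | bot =>
      have hus' : (u : ℝ) < δ := hus
      have ht := t.2.1
      -- As `u < δ`, this time is negative, and the window has length `(u + δ) / 2 < δ`.
      have := h (((u : ℝ) - δ) / 2) t u (by linarith) htu (by linarith)
      rwa [lineExtend_of_neg hT x (show ((u : ℝ) - δ) / 2 < 0 by linarith)] at this
    | coe s =>
      have hst' : s < t := WithBot.coe_lt_coe.1 hst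
      have := h s t u hst' htu hus
      rwa [lineExtend_coe hT x s] at this

theorem exists_lineExtend_windowSmall (hT : 0 < T) (x : Cadlag 0 T) {e : ℝ} (he : 0 < e) :
    ∃ δ > 0, WindowSmall (lineExtend hT x) δ e := by
  refine (lineExtend_isCadlag hT x).exists_windowSmall (a := 0) (b := T) ?_ ?_ he
  · intro s hs t ht
    rw [lineExtend_of_neg hT x hs, lineExtend_of_neg hT x ht]
  · intro s hs t ht
    rw [lineExtend_of_le hT x hs, lineExtend_of_le hT x ht]

theorem exists_lineExtend_oscPartition (hT : 0 < T) {x : Cadlag 0 T} {δ e : ℝ} (hδ : 0 < δ)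
    (hδε : δ ≤ ε) (he : 0 < e) (h : WindowSmall (lineExtend hT x) δ e) :
    ∃ L : List ℝ, L.length ≤ ⌈(T + ε) / (δ / 4)⌉₊ ∧
      OscPartition (lineExtend hT x) (δ / 4) (2 * e) (T + ε) (-ε) L ∧
      ∀ p ∈ L, p ∈ Icc (-ε) (T + ε) := by
  refine h.exists_oscPartition hδ he.le (lineExtend_isCadlag hT x).1
    (fun t ht => lineExtend_of_le hT x ht) (by linarith) _ _ ?_ (by linarith) fun v hv => ?_
  · have := Nat.le_ceil ((T + ε) / (δ / 4))
    rw [div_le_iff₀ (by positivity)] at this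
    linarith
  · rw [lineExtend_of_neg hT x (by linarith [hv.2]), lineExtend_of_neg hT x (by linarith)]
    simpa using he.le

theorem skorokhodDist_extend_le_of_code_eq (hT : 0 < T) {x y : Cadlag 0 T} {η e : ℝ}
    (hη : 0 < η) (he : 0 < e) {L L' : List ℝ}
    (h : OscPartition (lineExtend hT x) η (2 * e) (T + ε) (-ε) L)
    (h' : OscPartition (lineExtend hT y) η (2 * e) (T + ε) (-ε) L')
    (hcode : (-ε :: L).map (fun p => (⌊p / (e * η / 2)⌋, ⌊lineExtend hT x p / e⌋)) =
      (-ε :: L').map fun p => (⌊p / (e * η / 2)⌋, ⌊lineExtend hT y p / e⌋)) :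
    skorokhodDist (extend (ε := ε) hT x) (extend (ε := ε) hT y) ≤ 5 * e := by
  obtain ⟨γ, hγ, h1, h2, h3⟩ := h.exists_timeChange hη he h' hcode
  refine skorokhodDist_extend_le hT (by positivity) (fun s t hst => ?_) h1 h2
    fun t ht => (h3 t ht.1).trans (by linarith)
  obtain ⟨h4, h5⟩ := hγ s t hst
  have e1 : Real.exp (-(5 * e)) ≤ Real.exp (-e) := Real.exp_le_exp.2 (by linarith)
  have e2 : Real.exp e ≤ Real.exp (5 * e) := Real.exp_le_exp.2 (by linarith)
  exact ⟨(mul_le_mul_of_nonneg_right e1 (sub_nonneg.2 hst)).trans h4,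
    h5.trans (mul_le_mul_of_nonneg_right e2 (sub_nonneg.2 hst))⟩

end Cadlag

/-! ### Counting codes: separability and the compactness criterion. -/

theorem List.finite_setOf_length_le_of_forall_mem {α : Type*} {Q : Set α} (hQ : Q.Finite) (n : ℕ) :
    {l : List α | l.length ≤ n ∧ ∀ q ∈ l, q ∈ Q}.Finite := by
  have := hQ.to_subtype
  refine ((List.finite_length_le Q n).image (List.map Subtype.val)).subset ?_
  rintro l ⟨hl, hlQ⟩
  lift l to List Q using hlQ
  exact ⟨l, by simpa using hl, rfl⟩

theorem floor_div_mem_Icc {p a b m : ℝ} (hm : 0 < m) (hp : p ∈ Icc a b) :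
    ⌊p / m⌋ ∈ Icc ⌊a / m⌋ ⌊b / m⌋ :=
  ⟨Int.floor_le_floor (div_le_div_of_nonneg_right hp.1 hm.le),
    Int.floor_le_floor (div_le_div_of_nonneg_right hp.2 hm.le)⟩

namespace Cadlag

variable {T ε : ℝ}

theorem supAbs_le_iff (hT : 0 < T) {K : Set (Cadlag 0 T)} {M : ℝ} (hM : 0 ≤ M) :
    supAbs K ≤ ENNReal.ofReal M ↔ ∀ x ∈ K, ∀ t, |lineExtend hT x t| ≤ M := by
  simp only [supAbs, iSup_le_iff, ENNReal.ofReal_le_ofReal_iff hM]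
  refine forall₂_congr fun x _ => ⟨fun h t => ?_, fun h t => ?_⟩
  · by_cases ht : t < 0
    · simpa [lineExtend_of_neg hT x ht] using hM
    · simpa [lineExtend, ht] using h _
  · rw [← lineExtend_coe hT x t]
    exact h t

theorem supModulus_le_iff (hT : 0 < T) {K : Set (Cadlag 0 T)} {δ e : ℝ} (he : 0 ≤ e) :
    supModulus K δ ≤ ENNReal.ofReal e ↔ ∀ x ∈ K, WindowSmall (lineExtend hT x) δ e := by
  simp only [supModulus, iSup_le_iff, mJ1Modulus_le_iff hT he]

theorem tendsto_supModulus_iff (hT : 0 < T) {K : Set (Cadlag 0 T)} :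
    Tendsto (supModulus K) (𝓝[>] 0) (𝓝 0) ↔
      ∀ e > 0, ∃ δ > 0, ∀ x ∈ K, WindowSmall (lineExtend hT x) δ e := by
  rw [ENNReal.tendsto_nhds_zero]
  constructor
  · intro h e he
    obtain ⟨δ, hδ, hδ0⟩ := ((h (ENNReal.ofReal e) (ENNReal.ofReal_pos.2 he)).and
      self_mem_nhdsWithin).exists
    exact ⟨δ, hδ0, (supModulus_le_iff hT he.le).1 hδ⟩
  · intro h e he
    obtain ⟨e', he', hlt⟩ := ENNReal.lt_iff_exists_nnreal_btwn.1 he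
    obtain ⟨δ, hδ, hK⟩ := h e' (by exact_mod_cast he')
    filter_upwards [nhdsWithin_le_nhds (gt_mem_nhds hδ)] with δ' hδ'
    refine le_trans ?_ hlt.le
    rw [← ENNReal.ofReal_coe_nnreal]
    exact (supModulus_le_iff hT e'.2).2 fun x hx => (hK x hx).anti hδ'.le

theorem mJ1_separableSpace (hT : 0 < T) (hε : 0 < ε) :
    letI : MetricSpace (Cadlag 0 T) := mJ1MetricSpace hT hε
    TopologicalSpace.SeparableSpace (Cadlag 0 T) := by
  let _ : MetricSpace (Cadlag 0 T) := mJ1MetricSpace hT hε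
  have : SecondCountableTopology (Cadlag 0 T) := by
    refine Metric.secondCountable_of_countable_discretization fun e he => ?_
    have he5 : 0 < e / 5 := by linarith
    -- The window size depends on `x`; restricting it to `ε / (k + 1)` and recording `k` keeps the
    -- set of codes countable.
    have key : ∀ x : Cadlag 0 T, ∃ (k : ℕ) (L : List ℝ),
        OscPartition (lineExtend hT x) (ε / (k + 1) / 4) (2 * (e / 5)) (T + ε) (-ε) L := by
      intro x
      obtain ⟨δ, hδ, h⟩ := exists_lineExtend_windowSmall hT x he5
      obtain ⟨k, hk⟩ := exists_nat_ge (ε / δ)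
      have h1 : ε / (k + 1) ≤ δ := by
        rw [div_le_iff₀ hδ] at hk
        rw [div_le_iff₀ (by positivity)]
        linarith
      obtain ⟨L, -, hL, -⟩ := exists_lineExtend_oscPartition (ε := ε) hT
        (by positivity : 0 < ε / ((k : ℝ) + 1)) (div_le_self hε.le (by simp)) he5 (h.anti h1)
      exact ⟨k, L, hL⟩
    choose k L hL using key
    refine ⟨ℕ × List (ℤ × ℤ), inferInstance, fun x => (k x, (-ε :: L x).map fun p =>
      (⌊p / (e / 5 * (ε / (k x + 1) / 4) / 2)⌋, ⌊lineExtend hT x p / (e / 5)⌋)), ?_⟩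
    intro x y hxy
    obtain ⟨hk, hc⟩ := Prod.mk.inj hxy
    have hLy := hL y
    rw [← hk] at hc hLy
    refine (skorokhodDist_extend_le_of_code_eq hT (by positivity) he5 (hL x) hLy hc).trans ?_
    linarith
  infer_instance

theorem mJ1_totallyBounded (hT : 0 < T) (hε : 0 < ε) {K : Set (Cadlag 0 T)}
    (hK : supAbs K < ⊤) (hK' : Tendsto (supModulus K) (𝓝[>] 0) (𝓝 0)) :
    letI : MetricSpace (Cadlag 0 T) := mJ1MetricSpace hT hε
    TotallyBounded K := by
  let _ : MetricSpace (Cadlag 0 T) := mJ1MetricSpace hT hε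
  have hM := (supAbs_le_iff hT ENNReal.toReal_nonneg).1 (ENNReal.ofReal_toReal hK.ne).ge
  set M := (supAbs K).toReal
  refine Metric.totallyBounded_of_finite_discretization fun e he => ?_
  have he6 : 0 < e / 6 := by linarith
  obtain ⟨δ, hδ, hw⟩ := (tendsto_supModulus_iff hT).1 hK' _ he6
  have hη : 0 < min δ ε := lt_min hδ hε
  choose L hLlen hL hLmem using fun x : K => exists_lineExtend_oscPartition (ε := ε) hT hη
    (min_le_right δ ε) he6 ((hw x x.2).anti (min_le_left δ ε))
  set η := min δ ε
  set N := ⌈(T + ε) / (η / 4)⌉₊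
  set m := e / 6 * (η / 4) / 2 with hm
  have hmpos : 0 < m := by positivity
  have hQ : (Icc ⌊-ε / m⌋ ⌊(T + ε) / m⌋ ×ˢ Icc ⌊-M / (e / 6)⌋ ⌊M / (e / 6)⌋).Finite :=
    (finite_Icc _ _).prod (finite_Icc _ _)
  -- The extra entry in `N + 1` is the initial point `-ε`.
  refine ⟨_, (List.finite_setOf_length_le_of_forall_mem hQ (N + 1)).fintype,
    fun x => ⟨(-ε :: L x).map fun p => (⌊p / m⌋, ⌊lineExtend hT x p / (e / 6)⌋), ?_, ?_⟩, ?_⟩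
  · simpa using hLlen x
  · intro q hq
    obtain ⟨p, hp, rfl⟩ := List.mem_map.1 hq
    refine ⟨floor_div_mem_Icc hmpos ?_, floor_div_mem_Icc he6 (abs_le.1 (hM x x.2 p))⟩
    rcases List.mem_cons.1 hp with rfl | hp
    · exact ⟨le_rfl, by linarith⟩
    · exact hLmem x p hp
  · intro x y hxy
    refine (skorokhodDist_extend_le_of_code_eq hT (by positivity) he6 (hL x) (hL y)
      (Subtype.ext_iff.1 hxy)).trans_lt ?_
    linarith

theorem supAbs_lt_top_of_totallyBounded (hT : 0 < T) (hε : 0 < ε) {K : Set (Cadlag 0 T)}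
    (hK : letI : MetricSpace (Cadlag 0 T) := mJ1MetricSpace hT hε
      TotallyBounded K) : supAbs K < ⊤ := by
  let _ : MetricSpace (Cadlag 0 T) := mJ1MetricSpace hT hε
  obtain ⟨F, hF, hKF⟩ := Metric.totallyBounded_iff.1 hK 1 one_pos
  choose C hC using fun x : Cadlag 0 T => x.exists_bound
  obtain ⟨B, hB⟩ := (hF.image C).bddAbove
  have hB' : ∀ x ∈ K, ∀ t, |lineExtend hT x t| ≤ max B 0 + 1 := by
    intro x hx t
    obtain ⟨y, hy, hxy⟩ := mem_iUnion₂.1 (hKF hx)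
    obtain ⟨γ, -, -, h⟩ := exists_timeChange_of_skorokhodDist_lt hT hε hxy
    have h1 := h t
    have h2 : |lineExtend hT y (γ t)| ≤ max B 0 := by
      by_cases ht : γ t < 0
      · simp [lineExtend_of_neg hT y ht]
      · have h3 := hC y (projIcc 0 T hT.le (γ t))
        have h4 := hB (mem_image_of_mem C hy)
        simpa [lineExtend, ht] using Or.inl (h3.trans h4)
    have h3 := abs_sub_abs_le_abs_sub (lineExtend hT x t) (lineExtend hT y (γ t))
    linarith
  exact ((supAbs_le_iff hT (by positivity)).2 hB').trans_lt ENNReal.ofReal_lt_top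

theorem tendsto_supModulus_of_totallyBounded (hT : 0 < T) (hε : 0 < ε) {K : Set (Cadlag 0 T)}
    (hK : letI : MetricSpace (Cadlag 0 T) := mJ1MetricSpace hT hε
      TotallyBounded K) : Tendsto (supModulus K) (𝓝[>] 0) (𝓝 0) := by
  let _ : MetricSpace (Cadlag 0 T) := mJ1MetricSpace hT hε
  refine (tendsto_supModulus_iff hT).2 fun e he => ?_
  have he3 : 0 < e / 3 := by linarith
  obtain ⟨F, hF, hKF⟩ := Metric.totallyBounded_iff.1 hK (e / 3) he3
  choose δ hδ hw using fun x : Cadlag 0 T => exists_lineExtend_windowSmall hT x he3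
  obtain ⟨d, hd, hdF⟩ : ∃ d > 0, ∀ y ∈ F, d ≤ δ y := by
    rcases F.eq_empty_or_nonempty with rfl | hne
    · exact ⟨1, one_pos, by simp⟩
    · obtain ⟨y, -, hy⟩ := exists_min_image F δ hF hne
      exact ⟨δ y, hδ y, hy⟩
  -- The time change from the net point `y` to `x` may shrink windows by `exp (-(e / 3))` and costs
  -- `2 * (e / 3)` on top of the bound `e / 3` for `y`.
  refine ⟨Real.exp (-(e / 3)) * d, by positivity, fun x hx => ?_⟩
  obtain ⟨y, hy, hxy⟩ := mem_iUnion₂.1 (hKF hx)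
  rw [Metric.mem_ball, dist_comm] at hxy
  obtain ⟨γ, hγ, -, h⟩ := exists_timeChange_of_skorokhodDist_lt hT hε hxy
  have := ((hw y).anti (hdF y hy)).comp_timeChange hγ h
  rwa [show e / 3 + 2 * (e / 3) = e by ring] at this

theorem mJ1_isCompact_closure_iff (hT : 0 < T) (hε : 0 < ε) (K : Set (Cadlag 0 T)) :
    letI : MetricSpace (Cadlag 0 T) := mJ1MetricSpace hT hε
    IsCompact (closure K) ↔ supAbs K < ⊤ ∧ Tendsto (supModulus K) (𝓝[>] 0) (𝓝 0) := by
  let _ : MetricSpace (Cadlag 0 T) := mJ1MetricSpace hT hε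
  have : CompleteSpace (Cadlag 0 T) := mJ1_completeSpace hT hε
  constructor
  · intro h
    have hK := h.totallyBounded.subset subset_closure
    exact ⟨supAbs_lt_top_of_totallyBounded hT hε hK,
      tendsto_supModulus_of_totallyBounded hT hε hK⟩
  · rintro ⟨h1, h2⟩
    exact (mJ1_totallyBounded hT hε h1 h2).closure.isCompact_of_isClosed isClosed_closure

/-! ### Single jumps. -/

theorem lineExtend_singleJump (hT : 0 < T) (c : ℝ) (u : Icc 0 T) (t : ℝ) :
    lineExtend hT (singleJump c u) t = if t < u then 0 else c := by
  have hu := u.2.1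
  rcases lt_or_ge t 0 with ht | ht
  · rw [lineExtend_of_neg hT _ ht, if_pos (by linarith)]
  have h : u ≤ projIcc 0 T hT.le t ↔ (u : ℝ) ≤ t := by
    rw [← Subtype.coe_le_coe, coe_projIcc]
    rw [max_eq_right (le_min hT.le ht), le_min_iff, and_iff_right u.2.2]
  rw [lineExtend, if_neg ht.not_gt]
  show (Ici u).indicator (fun _ => c) (projIcc 0 T hT.le t) = _
  by_cases hut : (u : ℝ) ≤ t
  · rw [if_neg hut.not_gt, indicator_of_mem (mem_Ici.2 (h.2 hut))]
  · rw [if_pos (not_le.1 hut), indicator_of_notMem (s := Ici u) fun hm => hut (h.1 hm)]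

theorem mJ1_isCompact_closure_singleJump (hT : 0 < T) (hε : 0 < ε) {A : ℝ} (hA : 0 ≤ A) :
    letI : MetricSpace (Cadlag 0 T) := mJ1MetricSpace hT hε
    IsCompact (closure
      {x : Cadlag 0 T | ∃ c : ℝ, ∃ u : Icc 0 T, |c| ≤ A ∧ x = singleJump c u}) := by
  refine (mJ1_isCompact_closure_iff hT hε _).2
    ⟨((supAbs_le_iff hT hA).2 ?_).trans_lt ENNReal.ofReal_lt_top,
      (tendsto_supModulus_iff hT).2 fun e he => ⟨1, one_pos, ?_⟩⟩
  · rintro _ ⟨c, u, hc, rfl⟩ t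
    rw [lineExtend_singleJump]
    split_ifs
    · simpa using hA
    · exact hc
  -- The one jump cannot separate `t` from both `s` and `u`, so the minimum is `0` whatever the
  -- window length.
  · rintro _ ⟨c, v, -, rfl⟩ s t u hst htu -
    simp only [lineExtend_singleJump]
    rcases lt_or_ge t v with h | h
    · simpa [h, hst.trans h] using he.le
    · simpa [h.not_gt, (h.trans htu.le).not_gt] using he.le

end Cadlag

theorem theorem4p2 (T ε : ℝ) (hT : 0 < T) (hε : 0 < ε) :
    letI : MetricSpace (Cadlag 0 T) := Cadlag.mJ1MetricSpace hT hε
    (CompleteSpace (Cadlag 0 T) ∧ TopologicalSpace.SeparableSpace (Cadlag 0 T)) ∧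
    (∀ K : Set (Cadlag 0 T), IsCompact (closure K) ↔
      Cadlag.supAbs K < ⊤ ∧ Tendsto (Cadlag.supModulus K) (𝓝[>] 0) (𝓝 0)) ∧
    (∀ A : ℝ, 0 < A → IsCompact (closure
      {x : Cadlag 0 T | ∃ c : ℝ, ∃ u : Icc 0 T, |c| ≤ A ∧ x = Cadlag.singleJump c u})) :=
  ⟨⟨Cadlag.mJ1_completeSpace hT hε, Cadlag.mJ1_separableSpace hT hε⟩,
    Cadlag.mJ1_isCompact_closure_iff hT hε,
    fun _ hA => Cadlag.mJ1_isCompact_closure_singleJump hT hε hA.le⟩
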